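/- **Setting.** Let $\mathcal X$ be a finite non-empty set and $k:\mathcal X\times\mathcal X\to\mathbb R$ a positive semidefinite kernel with $k(x,x')\le 1$ for all $x,x'$. Let $f$ lie in the reproducing kernel Hilbert space of $k$, with $\|f\|_k\le B$. In rounds $t=1,\dots,T$ a learner chooses $x_t\in\mathcal X$ and observes $\tilde y_t=y_t+c_t$ with $y_t=f(x_t)+\epsilon_t$. The noise $\epsilon_t$ is $\sigma$-sub-Gaussian, $\mathbb E\,e^{s\epsilon_t}\le e^{s^2\sigma^2/2}$ for all $s\in\mathbb R$, and independent of everything that happened before round $t$. The corruption $c_t$ is chosen by an adversary who may use everything that has happened up to and including round $t$ (also $x_t$ and $\epsilon_t$), and $\sum_{t=1}^T|c_t|\le C$ almost surely, with $C\ge 0$ known. The regret is $R_T=\sum_{t=1}^T(\max_x f(x)-f(x_t))$. Fix $\lambda>0$. For points $v=(v_1,\dots,v_n)$ let $K_v=[k(v_i,v_j)]_{i,j}$, $k_v(x)=[k(v_i,x)]_i$, and, for $Y\in\mathbb R^n$, $\mu_v(x;Y)=k_v(x)^{T}(K_v+\lambda I)^{-1}Y$ and $\sigma_v^2(x)=k(x,x)-k_v(x)^{T}(K_v+\lambda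 I)^{-1}k_v(x)$ (so $\sigma_\emptyset^2(x)=k(x,x)$). Let $\gamma_t=\max_{v\in\mathcal X^t}\tfrac12\ln\det(I+\lambda^{-1}K_v)$. **Algorithm (RGP-PE)**, with parameters $\eta>1$, $\psi=\frac{\ln\eta}{2\gamma_T}$ and $\beta_0,\beta_1,\dots$. Set $\mathcal X_0=\mathcal X$. In epoch $h=0,1,\dots$, with $l_h=2^{h+1}$: 1. Start with $t'=0$. For $t=1,\dots,l_h$ select $s_t\in\arg\max_{x\in\mathcal X_h}\sigma_{(s_1,\dots,s_{t'})}(x)$ (ties are broken by any rule that returns the same point as long as the maximized function is the same); if $\det(I+\lambda^{-1}K_{(s_1,\dots,s_t)})>\eta\det(I+\lambda^{-1}K_{(s_1,\dots,s_{t'})})$, set $t'\leftarrow t$. 2. Play each distinct selected point $x$ exactly $u_h(x)=\lceil l_h\max\{\xi_h(x),\psi\}\rceil$ times, where $\xi_h(x)$ is its frequency among $s_1,\dots,s_{l_h}$, in any order that is fixed at the start of the epoch. Let $v^{(h)}$ be the sequence of the $u_h=\sum_x u_h(x)$ points played. 3. Let $\sigma^{(h)}=\sigma_{v^{(h)}}$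 and $\tilde\mu^{(h)}=\mu_{v^{(h)}}(\cdot\,;\tilde Y)$, where $\tilde Y[i]$ is the average of the $\tilde y_j$ of this epoch with $v^{(h)}_j=v^{(h)}_i$. With $w_h(x)=\big(\beta_h+\frac{C\sqrt{u_h}}{l_h\psi\lambda}\big)\sigma^{(h)}(x)$, let $\mathcal X_{h+1}=\{x\in\mathcal X_h:\tilde\mu^{(h)}(x)+w_h(x)\ge\max_{z\in\mathcal X_h}(\tilde\mu^{(h)}(z)-w_h(z))\}$. The algorithm terminates when $T$ actions have been played (so the last epoch may be incomplete; in what follows only the actions that were played count). Let $\mu^{(h)}$ be the posterior mean computed (hypothetically) in the same way from the uncorrupted observations $y_j$ of epoch $h$. **Statement.** Let $\delta\in(0,1)$ and run the algorithm with $$\beta_h=B+\frac{\sigma}{\sqrt\lambda}\sqrt{2\log\frac{|\mathcal X|}{\delta_h}},\qquad \delta_h=\frac{6\delta}{(h+1)^2\pi^2}.$$ (a) *Regular confidence bounds.* $\beta_h$ is non-decreasing in $h$. With probability at least $1-\delta$, $\mu^{(h)}(x)-f(x)\le\beta_h\sigma^{(h)}(x)$ for all $h\ge0$ and $x\in\mathcal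 X$ simultaneously. With probability at least $1-\delta$, $f(x)-\mu^{(h)}(x)\le\beta_h\sigma^{(h)}(x)$ for all $h\ge0$ and $x\in\mathcal X$ simultaneously. Hence, with probability at least $1-2\delta$, $|\mu^{(h)}(x)-f(x)|\le\beta_h\sigma^{(h)}(x)$ for all $h\ge0$ and $x\in\mathcal X$ simultaneously. (b) *Regret.* With probability at least $1-\delta$, $R_T=O^*\big(\sqrt{T\gamma_T}+C\gamma_T^{3/2}\big)$. Precisely: there is a constant $K$ that depends only on $B,\sigma,\lambda,\eta$ such that, for all $\mathcal X$, $k$, $f$, $T\ge1$, $C\ge0$, $\delta\in(0,1)$, noise and adversaries as above, with probability at least $1-\delta$, $$R_T\le K\,(1+\log T)\Big(\sqrt{1+\log\tfrac{|\mathcal X|}{\delta}+\log(1+\log T)}\;\sqrt{T\gamma_T}+C\,\gamma_T^{3/2}\Big).$$ -/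

import Mathlib

open scoped NNReal

noncomputable section

namespace RGPPE

/-! ### Gaussian process posteriors

A finite sequence of points is a map `v : ι → X` from a finite index type. -/

section Posterior

variable {X ι : Type*} [Fintype ι] [DecidableEq ι]

/-- The kernel matrix of a sequence of points. -/
def gram (k : X → X → ℝ) (v : ι → X) : Matrix ι ι ℝ :=
  Matrix.of fun i j => k (v i) (v j)

/-- The vector `(k(v i, x))_i`. -/
def kvec (k : X → X → ℝ) (v : ι → X) (x : X) : ι → ℝ :=
  fun i => k (v i) x

/-- Posterior mean at `x`, with regularization `lam`, from observations `y` at the points `v`. -/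
def postMean (k : X → X → ℝ) (lam : ℝ) (v : ι → X) (y : ι → ℝ) (x : X) : ℝ :=
  dotProduct (kvec k v x) (Matrix.mulVec (gram k v + lam • (1 : Matrix ι ι ℝ))⁻¹ y)

/-- Posterior variance at `x` given the points `v`. Without points it is `k x x`. -/
def postVar (k : X → X → ℝ) (lam : ℝ) (v : ι → X) (x : X) : ℝ :=
  k x x -
    dotProduct (kvec k v x) (Matrix.mulVec (gram k v + lam • (1 : Matrix ι ι ℝ))⁻¹ (kvec k v x))

/-- Posterior standard deviation. -/
def postStd (k : X → X → ℝ) (lam : ℝ) (v : ι → X) (x : X) : ℝ :=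
  Real.sqrt (postVar k lam v x)

/-- `det (I + lam⁻¹ K)`. -/
def gainDet (k : X → X → ℝ) (lam : ℝ) (v : ι → X) : ℝ :=
  (1 + lam⁻¹ • gram k v).det

/-- Maximum information gain after `t` points. -/
def maxInfoGain (k : X → X → ℝ) (lam : ℝ) (t : ℕ) : ℝ :=
  ⨆ v : Fin t → X, (1 / 2) * Real.log (gainDet k lam v)

/-- Each observation is replaced by the average of all observations at the same point. -/
def avgObs [DecidableEq X] (v : ι → X) (y : ι → ℝ) : ι → ℝ :=
  fun i => (∑ j, if v i = v j then y j else 0) / (∑ j, if v i = v j then (1 : ℝ) else 0)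

/-- The robust posterior mean: the posterior mean of the averaged observations. -/
def robustMean [DecidableEq X] (k : X → X → ℝ) (lam : ℝ) (v : ι → X) (y : ι → ℝ) (x : X) : ℝ :=
  postMean k lam v (avgObs v y) x

end Posterior

/-! ### The algorithm -/

/-- The choices that the algorithm leaves open. `select h A s` is a maximizer of `s` over the
active set `A` in epoch `h` (ties are broken arbitrarily, but the same point is returned whenever
`s` is the same), and `arrange h m` is the order in which the plays `m` of epoch `h` are made. -/
structure PlayRule (X : Type*) where
  select : ℕ → Finset X → (X → ℝ) → X
  select_mem : ∀ (h : ℕ) (A : Finset X) (s : X → ℝ), A.Nonempty → select h A s ∈ A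
  le_select : ∀ (h : ℕ) (A : Finset X) (s : X → ℝ), ∀ x ∈ A, s x ≤ s (select h A s)
  arrange : ℕ → Multiset X → List X
  coe_arrange : ∀ (h : ℕ) (m : Multiset X), (arrange h m : Multiset X) = m

/-- The input of the algorithm: kernel, regularization parameter, switching parameter, truncation
parameter, corruption budget, confidence parameters, and the play rule. -/
structure Config (X : Type*) where
  k : X → X → ℝ
  lam : ℝ
  eta : ℝ
  psi : ℝ
  C : ℝ
  beta : ℕ → ℝ
  rule : PlayRule X

namespace Config

variable {X : Type*} (cfg : Config X)

/-- `l_h = 2^(h+1)`. -/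
def len (h : ℕ) : ℕ := 2 ^ (h + 1)

/-- One iteration of the selection loop of epoch `h` with active set `A`. The state `(p, q)`
consists of the points `p` selected so far and of the initial segment `q` of `p` of length `t'`
(the points selected up to the last switch). -/
def loopStep (h : ℕ) (A : Finset X) (s : List X × List X) : List X × List X :=
  let p := s.1 ++ [cfg.rule.select h A (postStd cfg.k cfg.lam s.2.get)]
  if gainDet cfg.k cfg.lam p.get > cfg.eta * gainDet cfg.k cfg.lam s.2.get then (p, p)
  else (p, s.2)

/-- The `l_h` points selected by the loop. -/
def loopPoints (h : ℕ) (A : Finset X) : List X :=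
  ((cfg.loopStep h A)^[len h] ([], [])).1

variable [DecidableEq X]

/-- Empirical frequency `ξ_h(x)` of `x` among the selected points. -/
def freq (h : ℕ) (A : Finset X) (x : X) : ℝ :=
  ((cfg.loopPoints h A).count x : ℝ) / len h

/-- Number of plays `u_h(x) = ⌈l_h max(ξ_h(x), ψ)⌉` of a selected point `x`. -/
def numPlays (h : ℕ) (A : Finset X) (x : X) : ℕ :=
  ⌈(len h : ℝ) * max (cfg.freq h A x) cfg.psi⌉₊

/-- The actions of epoch `h` with active set `A`, in the order in which they are taken: each
selected point `x` exactly `u_h(x)` times. -/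
def epochPlays (h : ℕ) (A : Finset X) : List X :=
  cfg.rule.arrange h
    (∑ x ∈ (cfg.loopPoints h A).toFinset, Multiset.replicate (cfg.numPlays h A x) x)

/-- Half-width of the enlarged confidence interval at `x` after epoch `h`. -/
def width (h : ℕ) (A : Finset X) (x : X) : ℝ :=
  (cfg.beta h +
      cfg.C * Real.sqrt (cfg.epochPlays h A).length / (len h * cfg.psi * cfg.lam)) *
    postStd cfg.k cfg.lam (cfg.epochPlays h A).get x

open Classical in
/-- The active set after epoch `h`, where `y` are the corrupted rewards of the epoch. -/
def eliminate (h : ℕ) (A : Finset X) (y : Fin (cfg.epochPlays h A).length → ℝ) : Finset X :=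
  A.filter fun x => ∀ z ∈ A,
    robustMean cfg.k cfg.lam (cfg.epochPlays h A).get y z - cfg.width h A z ≤
      robustMean cfg.k cfg.lam (cfg.epochPlays h A).get y x + cfg.width h A x

variable [Fintype X]

/-- The active set of epoch `h` and the number of rounds before epoch `h`, when the reward
observed in round `t` (rounds are numbered from `0`) for the action `x` is `f x + e t`. -/
def epochStart (f : X → ℝ) (e : ℕ → ℝ) : ℕ → Finset X × ℕ
  | 0 => (Finset.univ, 0)
  | h + 1 =>
    let A := (epochStart f e h).1
    let τ := (epochStart f e h).2
    (cfg.eliminate h A fun j => f ((cfg.epochPlays h A).get j) + e (τ + j),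
      τ + (cfg.epochPlays h A).length)

/-- The actions that a run of `T` rounds takes in epoch `h` (all actions of the epoch, unless the
run terminates before). -/
def playsUntil (f : X → ℝ) (e : ℕ → ℝ) (T h : ℕ) : List X :=
  (cfg.epochPlays h (cfg.epochStart f e h).1).take (T - (cfg.epochStart f e h).2)

/-- The actions of a run of `T` rounds. At least one action is taken in each epoch, so the first
`T` epochs suffice. -/
def actions (f : X → ℝ) (e : ℕ → ℝ) (T : ℕ) : List X :=
  (List.range T).flatMap (cfg.playsUntil f e T)

/-- Cumulative regret of a run of `T` rounds. -/
def regret (f : X → ℝ) (e : ℕ → ℝ) (T : ℕ) : ℝ :=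
  ((cfg.actions f e T).map fun x => (⨆ z, f z) - f x).sum

/-- The hypothetical posterior mean after epoch `h` of a run of `T` rounds, computed from the
uncorrupted observations of that epoch. Here `ε t` is the noise and `c t` is the corruption of
round `t`. -/
def cleanMean (f : X → ℝ) (ε c : ℕ → ℝ) (T h : ℕ) (x : X) : ℝ :=
  let v := (cfg.playsUntil f (ε + c) T h).get
  postMean cfg.k cfg.lam v (fun j => f (v j) + ε ((cfg.epochStart f (ε + c) h).2 + j)) x

/-- The posterior standard deviation after epoch `h` of a run of `T` rounds. -/
def epochStd (f : X → ℝ) (ε c : ℕ → ℝ) (T h : ℕ) (x : X) : ℝ :=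
  postStd cfg.k cfg.lam (cfg.playsUntil f (ε + c) T h).get x

end Config

/-! ### Confidence parameters, noise and corruption -/

/-- `δ_h = 6 δ / ((h+1)² π²)`. -/
def deltaSeq (δ : ℝ) (h : ℕ) : ℝ := 6 * δ / (((h : ℝ) + 1) ^ 2 * Real.pi ^ 2)

/-- `β_h = B + (σ / √lam) √(2 log (n / δ_h))`, with `n` the number of points of the domain. -/
def betaSeq (B σ lam : ℝ) (n : ℕ) (δ : ℝ) (h : ℕ) : ℝ :=
  B + σ / Real.sqrt lam * Real.sqrt (2 * Real.log (n / deltaSeq δ h))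

/-- The algorithm with switching parameter `η`, truncation parameter `log η / (2 γ_T)` and the
confidence parameters `betaSeq`. -/
def mainConfig {X : Type*} [Fintype X] (k : X → X → ℝ) (B σ lam η C δ : ℝ) (T : ℕ)
    (rule : PlayRule X) : Config X where
  k := k
  lam := lam
  eta := η
  psi := Real.log η / (2 * maxInfoGain k lam T)
  C := C
  beta := betaSeq B σ lam (Fintype.card X) δ
  rule := rule

/-- The reproducing kernel, as a real-valued function, of a Hilbert space `H` of real functions. -/
def rkernel {X : Type*} (H : Type*) [NormedAddCommGroup H] [InnerProductSpace ℝ H]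
    [CompleteSpace H] [RKHS ℝ H X ℝ] (x y : X) : ℝ :=
  RKHS.kernel H x y 1

open MeasureTheory ProbabilityTheory in
/-- The noise `ε` and the corruption `c`. The σ-algebra `ℱ t` holds what is known before round
`t`. The noise of round `t` is `σ`-sub-Gaussian and independent of `ℱ t`; in particular the
`ε t` are independent. The adversary is not anticipating: `c t` may depend in any way, also with
extra randomness, on everything up to round `t`, including the action and the noise of round `t`.
The corruptions of the first `T` rounds add up to at most `C`. -/
structure IsCorruptedNoise {Ω : Type*} [mΩ : MeasurableSpace Ω] (μ : Measure Ω)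
    (ℱ : Filtration ℕ mΩ) (σ : ℝ≥0) (C : ℝ) (T : ℕ) (ε c : ℕ → Ω → ℝ) : Prop where
  measurable_noise : ∀ t, Measurable[ℱ (t + 1)] (ε t)
  subgaussian_noise : ∀ t, HasSubgaussianMGF (ε t) (σ ^ 2) μ
  indep_noise : ∀ t, Indep (MeasurableSpace.comap (ε t) inferInstance) (ℱ t) μ
  measurable_corruption : ∀ t, Measurable[ℱ (t + 1)] (c t)
  budget : ∀ᵐ ω ∂μ, ∑ t ∈ Finset.range T, |c t ω| ≤ C

open MeasureTheory in
/-- Regular confidence bounds at level `p` for the run of `T` rounds: the sequence `cfg.beta` is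
non-decreasing, and with probability at least `1 - p`, `|μ^(h)(x) - f(x)| ≤ β_h σ^(h)(x)` for all
epochs `h` and all `x` simultaneously. -/
def RegularConfidenceBounds {X Ω : Type*} [Fintype X] [DecidableEq X] [MeasurableSpace Ω]
    (μ : Measure Ω) (cfg : Config X) (f : X → ℝ) (ε c : ℕ → Ω → ℝ) (T : ℕ) (p : ℝ) : Prop :=
  Monotone cfg.beta ∧
    1 - p ≤ μ.real {ω | ∀ h x,
      |cfg.cleanMean f (fun t => ε t ω) (fun t => c t ω) T h x - f x| ≤
        cfg.beta h * cfg.epochStd f (fun t => ε t ω) (fun t => c t ω) T h x}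

end RGPPE

end

/-! Write the kernel as an inner product of features. The posterior variance at `x` is the minimum
over coefficients a of ‖φ x - ∑ a_j φ(v_j)‖² + λ ∑ a_j², attained at `postWeights` (`postVar_eq`,
`postVar_le`). Variances are compared by inserting trial coefficients. The same formula bounds the
bias of the posterior mean by ‖g‖ times the standard deviation, and the sum of squared weights by
the variance over λ.

Confidence: the points and weights of an epoch are determined by its active set and starting round.
On the event that these take a given value, the noise of the epoch is fresh, so a Chernoff bound
applies. These events partition the space, so summing over them costs nothing
(`measure_not_confidence_le`).

Corruption: positions with the same point have the same weight, so averaging does not change the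
posterior mean. Each played point occurs at least l_h ψ times, hence no weight exceeds the standard
deviation over √(λ l_h ψ), and the corruption shifts the mean by at most C times that.

Rare switching: determinant times variance never decreases when a point is appended, and between
switches the determinant grows by at most the factor η. So the stale maximizer has, up to η, the
largest current variance, and the usual log-determinant potential bounds l_h σ² by a multiple of γ_T
(`len_mul_postVar_epochPlays_le`). A switch raises the determinant by more than η, so there are at
most 1/ψ switches and one more distinct point than switches; truncation therefore lengthens an epoch
only by a constant factor (`length_epochPlays_le`).

Regret: a point that survives an epoch has a gap of at most four typical widths, so the next epoch
costs O(β √(Tγ) + C γ^(3/2)), and there are O(1 + log T) epochs. Elimination needs only one side of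
the confidence bound at each point (the opposite side at one fixed maximizer), which gives
probability 1 - δ. If γ_T is too small for ψ ≤ 1 and λψ ≤ 1, the kernel is so small that every run
has small regret. -/

noncomputable section

namespace RGPPE

/-! ### Posterior mean and variance as kernel ridge regression. -/

section PosteriorTheory

variable {X ι κ : Type*} [Fintype ι] [DecidableEq ι] [Fintype κ] [DecidableEq κ]

/-- The weights of the observations in the posterior mean. -/
def postWeights (k : X → X → ℝ) (lam : ℝ) (v : ι → X) (x : X) : ι → ℝ :=
  Matrix.mulVec (gram k v + lam • (1 : Matrix ι ι ℝ))⁻¹ (kvec k v x)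

variable {H : Type*} [NormedAddCommGroup H] [InnerProductSpace ℝ H]

/-- `φ` is a feature map of the kernel `k`. -/
def IsFeatureMap (φ : X → H) (k : X → X → ℝ) : Prop :=
  ∀ x y, k x y = inner ℝ (φ x) (φ y)

variable {φ : X → H} {k : X → X → ℝ} {lam : ℝ}

namespace IsFeatureMap

lemma symm (hk : IsFeatureMap φ k) (x y : X) : k x y = k y x := by
  rw [hk, hk, real_inner_comm]

lemma self_eq_norm_sq (hk : IsFeatureMap φ k) (x : X) : k x x = ‖φ x‖ ^ 2 := by
  rw [hk, real_inner_self_eq_norm_sq]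

lemma self_nonneg (hk : IsFeatureMap φ k) (x : X) : 0 ≤ k x x := by
  rw [hk.self_eq_norm_sq]; positivity

lemma posSemidef_gram {ι : Type*} [Fintype ι] (hk : IsFeatureMap φ k) (v : ι → X) : (gram k v).PosSemidef := by
  have : gram k v = Matrix.gram ℝ (fun i => φ (v i)) := by
    ext i j; simp [gram, Matrix.gram, hk (v i) (v j)]
  rw [this]
  exact Matrix.posSemidef_gram ℝ _

lemma posDef_gram_add (hk : IsFeatureMap φ k) (hlam : 0 < lam) (v : ι → X) :
    (gram k v + lam • (1 : Matrix ι ι ℝ)).PosDef :=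
  Matrix.PosDef.posSemidef_add (hk.posSemidef_gram v) (Matrix.PosDef.one.smul hlam)

lemma isUnit_det_gram_add (hk : IsFeatureMap φ k) (hlam : 0 < lam) (v : ι → X) :
    IsUnit (gram k v + lam • (1 : Matrix ι ι ℝ)).det :=
  (hk.posDef_gram_add hlam v).det_pos.ne'.isUnit

lemma gram_add_mulVec_postWeights (hk : IsFeatureMap φ k) (hlam : 0 < lam) (v : ι → X) (x : X)
    (i : ι) :
    ∑ j, k (v i) (v j) * postWeights k lam v x j + lam * postWeights k lam v x i = k (v i) x := by
  have h : Matrix.mulVec (gram k v + lam • (1 : Matrix ι ι ℝ)) (postWeights k lam v x) =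
      kvec k v x := by
    rw [postWeights, Matrix.mulVec_mulVec, Matrix.mul_nonsing_inv _
      (hk.isUnit_det_gram_add hlam v), Matrix.one_mulVec]
  have := congrFun h i
  rw [Matrix.add_mulVec, Matrix.smul_mulVec, Matrix.one_mulVec] at this
  simpa [Matrix.mulVec, dotProduct, gram, kvec] using this

/-- The normal equations of kernel ridge regression. -/
lemma inner_residual (hk : IsFeatureMap φ k) (hlam : 0 < lam) (v : ι → X) (x : X) (i : ι) :
    inner ℝ (φ (v i)) (φ x - ∑ j, postWeights k lam v x j • φ (v j)) =
      lam * postWeights k lam v x i := by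
  rw [inner_sub_right, inner_sum, ← hk, ← hk.gram_add_mulVec_postWeights hlam v x i]
  simp only [inner_smul_right, ← hk (v i)]
  rw [add_sub_right_comm, sub_eq_zero.2, zero_add]
  exact Finset.sum_congr rfl fun j _ => mul_comm _ _

lemma postMean_eq_sum (hk : IsFeatureMap φ k) (hlam : 0 < lam) (v : ι → X) (y : ι → ℝ) (x : X) :
    postMean k lam v y x = ∑ i, postWeights k lam v x i * y i := by
  have hT : ((gram k v + lam • (1 : Matrix ι ι ℝ))⁻¹).transpose =
      (gram k v + lam • (1 : Matrix ι ι ℝ))⁻¹ := by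
    have := (hk.posDef_gram_add hlam v).isHermitian.inv
    rwa [Matrix.IsHermitian, Matrix.conjTranspose_eq_transpose_of_trivial] at this
  rw [postMean, Matrix.dotProduct_mulVec, ← Matrix.mulVec_transpose, hT]
  rfl

/-- By the normal equations the residual has inner product λ ∑ w_j² with the fitted combination.
Subtracting the fit from `φ x` therefore splits the variance into squared residual and ridge
penalty. -/
lemma postVar_eq (hk : IsFeatureMap φ k) (hlam : 0 < lam) (v : ι → X) (x : X) :
    postVar k lam v x = ‖φ x - ∑ j, postWeights k lam v x j • φ (v j)‖ ^ 2 +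
      lam * ∑ j, postWeights k lam v x j ^ 2 := by
  set w := postWeights k lam v x with hw
  set r := φ x - ∑ j, w j • φ (v j) with hr
  have h1 : postVar k lam v x = inner ℝ (φ x) r := by
    rw [hr, inner_sub_right, inner_sum, ← hk, postVar]
    congr 1
    refine Finset.sum_congr rfl fun j _ => ?_
    rw [inner_smul_right, ← hk, kvec, hk.symm x, mul_comm]
    rfl
  have h2 : inner ℝ (∑ j, w j • φ (v j)) r = lam * ∑ j, w j ^ 2 := by
    rw [sum_inner, Finset.mul_sum]
    refine Finset.sum_congr rfl fun j _ => ?_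
    rw [real_inner_smul_left, hr, hw, hk.inner_residual hlam]
    ring
  rw [h1, ← real_inner_self_eq_norm_sq, ← h2, ← inner_add_left, hr, sub_add_cancel]

/-- The cross terms between the optimum and a perturbation cancel by the normal equations. This is
the tool for all variance comparisons: any choice of `a` gives an upper bound. -/
lemma postVar_le (hk : IsFeatureMap φ k) (hlam : 0 < lam) (v : ι → X) (x : X) (a : ι → ℝ) :
    postVar k lam v x ≤ ‖φ x - ∑ j, a j • φ (v j)‖ ^ 2 + lam * ∑ j, a j ^ 2 := by
  rw [hk.postVar_eq hlam]
  set w := postWeights k lam v x with hw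
  set r := φ x - ∑ j, w j • φ (v j) with hr
  set d : H := ∑ j, (a j - w j) • φ (v j) with hd
  have e1 : φ x - ∑ j, a j • φ (v j) = r - d := by
    simp only [hr, hd, sub_smul, Finset.sum_sub_distrib]
    abel
  have e2 : inner ℝ r d = lam * ∑ j, (a j - w j) * w j := by
    rw [real_inner_comm, hd, sum_inner, Finset.mul_sum]
    refine Finset.sum_congr rfl fun j _ => ?_
    rw [real_inner_smul_left, hr, hw, hk.inner_residual hlam]
    ring
  have e3 : ∑ j, a j ^ 2 =
      ∑ j, w j ^ 2 + 2 * ∑ j, (a j - w j) * w j + ∑ j, (a j - w j) ^ 2 := by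
    rw [Finset.mul_sum, ← Finset.sum_add_distrib, ← Finset.sum_add_distrib]
    exact Finset.sum_congr rfl fun j _ => by ring
  have e4 : 0 ≤ ∑ j, (a j - w j) ^ 2 := Finset.sum_nonneg fun j _ => sq_nonneg _
  rw [e1, norm_sub_sq_real r d, e2, e3]
  nlinarith [mul_nonneg hlam.le e4, sq_nonneg ‖d‖]

lemma postVar_nonneg (hk : IsFeatureMap φ k) (hlam : 0 < lam) (v : ι → X) (x : X) :
    0 ≤ postVar k lam v x := by
  rw [hk.postVar_eq hlam]
  have := Finset.sum_nonneg fun j (_ : j ∈ Finset.univ) => sq_nonneg (postWeights k lam v x j)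
  positivity

lemma sq_postStd (hk : IsFeatureMap φ k) (hlam : 0 < lam) (v : ι → X) (x : X) :
    postStd k lam v x ^ 2 = postVar k lam v x :=
  Real.sq_sqrt (hk.postVar_nonneg hlam v x)

lemma postVar_le_self (hk : IsFeatureMap φ k) (hlam : 0 < lam) (v : ι → X) (x : X) :
    postVar k lam v x ≤ k x x := by
  simpa [hk.self_eq_norm_sq] using hk.postVar_le hlam v x 0

lemma sum_sq_postWeights_le (hk : IsFeatureMap φ k) (hlam : 0 < lam) (v : ι → X) (x : X) :
    lam * ∑ j, postWeights k lam v x j ^ 2 ≤ postVar k lam v x := by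
  rw [hk.postVar_eq hlam]
  exact le_add_of_nonneg_left (sq_nonneg _)

/-- The bias of the posterior mean. -/
lemma abs_sum_postWeights_mul_sub_le (hk : IsFeatureMap φ k) (hlam : 0 < lam) (v : ι → X) (x : X)
    (g : H) : |∑ j, postWeights k lam v x j * inner ℝ g (φ (v j)) - inner ℝ g (φ x)| ≤
      ‖g‖ * postStd k lam v x := by
  have e : ∑ j, postWeights k lam v x j * inner ℝ g (φ (v j)) - inner ℝ g (φ x) =
      - inner ℝ g (φ x - ∑ j, postWeights k lam v x j • φ (v j)) := by
    rw [inner_sub_right, inner_sum]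
    simp only [inner_smul_right]
    ring
  rw [e, abs_neg]
  refine (abs_real_inner_le_norm _ _).trans (mul_le_mul_of_nonneg_left ?_ (norm_nonneg _))
  refine Real.le_sqrt_of_sq_le ?_
  rw [hk.postVar_eq hlam]
  have := Finset.sum_nonneg fun j (_ : j ∈ Finset.univ) => sq_nonneg (postWeights k lam v x j)
  nlinarith

/-- Observations at the same point have the same weight. -/
lemma exists_postWeights_eq (hk : IsFeatureMap φ k) (hlam : 0 < lam) (v : ι → X) (x : X) :
    ∃ g : X → ℝ, ∀ i, postWeights k lam v x i = g (v i) := by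
  -- The i-th normal equation solved for the i-th weight; its right side depends on `i` only through
  -- `v i`.
  refine ⟨fun z => (k z x - ∑ j, k z (v j) * postWeights k lam v x j) / lam, fun i => ?_⟩
  rw [eq_div_iff hlam.ne', ← hk.gram_add_mulVec_postWeights hlam v x i]
  ring

/-- Equal points have equal weights, so exchanging the sums over positions and over their duplicates
returns each observation with its original weight. The corrupted and clean means can thus be
compared as plain weighted sums. -/
lemma robustMean_eq_postMean [DecidableEq X] (hk : IsFeatureMap φ k) (hlam : 0 < lam) (v : ι → X)
    (y : ι → ℝ) (x : X) : robustMean k lam v y x = postMean k lam v y x := by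
  obtain ⟨g, hg⟩ := hk.exists_postWeights_eq hlam v x
  rw [robustMean, hk.postMean_eq_sum hlam, hk.postMean_eq_sum hlam]
  simp only [hg, avgObs]
  have hpos : ∀ i, 0 < ∑ j, if v i = v j then (1 : ℝ) else 0 := fun i =>
    Finset.sum_pos' (fun j _ => by split_ifs <;> norm_num) ⟨i, Finset.mem_univ _, by simp⟩
  have : ∀ i, g (v i) * ((∑ j, if v i = v j then y j else 0) /
      ∑ j, if v i = v j then (1 : ℝ) else 0) =
      ∑ j, if v i = v j then g (v j) * y j * (∑ l, if v j = v l then (1 : ℝ) else 0)⁻¹ else 0 := by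
    intro i
    rw [div_eq_mul_inv, Finset.sum_mul, Finset.mul_sum]
    refine Finset.sum_congr rfl fun j _ => ?_
    split_ifs with h
    · simp only [h]; ring
    · simp
  simp only [this]
  rw [Finset.sum_comm]
  refine Finset.sum_congr rfl fun j _ => ?_
  have : ∀ i, (if v i = v j then g (v j) * y j * (∑ l, if v j = v l then (1 : ℝ) else 0)⁻¹ else 0) =
      g (v j) * y j * (∑ l, if v j = v l then (1 : ℝ) else 0)⁻¹ *
        (if v j = v i then (1 : ℝ) else 0) := by
    intro i
    by_cases h : v i = v j
    · simp [h]
    · simp [h, Ne.symm h]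
  simp only [this]
  rw [← Finset.mul_sum, mul_assoc, inv_mul_cancel₀ (hpos j).ne', mul_one]

/-- In the optimal combination that uses `y`, replace `φ y` by its own ridge prediction from `v`.
The residual of that prediction enters with coefficient `b`, and Young's inequality with parameter
`s` separates it from the rest. -/
lemma postVar_elim_le (hk : IsFeatureMap φ k) (hlam : 0 < lam) (v : ι → X) (x y : X) :
    postVar k lam v x ≤ (1 + postVar k lam v y / lam) *
      postVar k lam (Sum.elim v fun _ : Unit => y) x := by
  set s := postVar k lam v y / lam with hs
  set v' := Sum.elim v fun _ : Unit => y with hv'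
  set w := postWeights k lam v' x with hw
  set b := w (Sum.inr ()) with hb
  set a := fun i => w (Sum.inl i) with ha
  set a' := postWeights k lam v y with ha'
  set u := φ x - ∑ j, w j • φ (v' j) with hu
  set r := φ y - ∑ j, a' j • φ (v j) with hr
  have hs0 : 0 ≤ s := div_nonneg (hk.postVar_nonneg hlam _ _) hlam.le
  have h1 := hk.postVar_le hlam v x (fun i => a i + b * a' i)
  have e1 : φ x - ∑ j, (a j + b * a' j) • φ (v j) = u + b • r := by
    simp only [hu, hr, Fintype.sum_sum_type, hv', Sum.elim_inl, Sum.elim_inr, Finset.univ_unique,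
      Finset.sum_singleton, add_smul, Finset.sum_add_distrib, smul_sub, Finset.smul_sum, mul_smul]
    simp only [ha, hb]
    change _ = φ x - (∑ j, w (Sum.inl j) • φ (v j) + w (Sum.inr ()) • φ y) + _
    abel
  have h2 : postVar k lam v' x = ‖u‖ ^ 2 + lam * (∑ j, a j ^ 2 + b ^ 2) := by
    rw [hk.postVar_eq hlam]
    simp [Fintype.sum_sum_type, hu, hw, ha, hb]
  have h3 : s * lam = ‖r‖ ^ 2 + lam * ∑ j, a' j ^ 2 := by
    rw [hs, div_mul_cancel₀ _ hlam.ne', hk.postVar_eq hlam]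
  rw [e1] at h1
  have n1 : s * ‖u + b • r‖ ^ 2 ≤ s * (1 + s) * ‖u‖ ^ 2 + (1 + s) * b ^ 2 * ‖r‖ ^ 2 := by
    have := sq_nonneg ‖s • u - b • r‖
    rw [norm_sub_sq_real, norm_smul, norm_smul, real_inner_smul_left, real_inner_smul_right,
      mul_pow, mul_pow, Real.norm_eq_abs, Real.norm_eq_abs, sq_abs, sq_abs] at this
    rw [norm_add_sq_real, norm_smul, real_inner_smul_right, mul_pow, Real.norm_eq_abs, sq_abs]
    nlinarith
  have n2 : s * ∑ j, (a j + b * a' j) ^ 2 ≤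
      s * (1 + s) * ∑ j, a j ^ 2 + (1 + s) * b ^ 2 * ∑ j, a' j ^ 2 := by
    simp only [Finset.mul_sum]
    rw [← Finset.sum_add_distrib]
    refine Finset.sum_le_sum fun j _ => ?_
    nlinarith [sq_nonneg (s * a j - b * a' j)]
  -- Young's inequality was multiplied by `s`, so it is void for `s = 0`. In that case `y` is
  -- predicted exactly with zero weights, and dropping it costs nothing.
  rcases hs0.eq_or_lt with h0 | h0
  · rw [← h0, zero_mul] at h3
    have q2 : 0 ≤ ∑ j, a' j ^ 2 := Finset.sum_nonneg fun j _ => sq_nonneg _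
    have q3 : ∑ j, a' j ^ 2 = 0 := by
      have := mul_nonneg hlam.le q2
      have : lam * ∑ j, a' j ^ 2 = 0 := by nlinarith [sq_nonneg ‖r‖]
      exact (mul_eq_zero.1 this).resolve_left hlam.ne'
    have q4 : r = 0 := by
      rw [q3, mul_zero, add_zero] at h3
      exact norm_eq_zero.1 (pow_eq_zero_iff two_ne_zero |>.1 h3.symm)
    have q5 : ∀ j, a' j = 0 := fun j => by
      have := (Finset.sum_eq_zero_iff_of_nonneg fun j _ => sq_nonneg (a' j)).1 q3 j
        (Finset.mem_univ _)
      exact pow_eq_zero_iff two_ne_zero |>.1 this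
    simp only [q4, q5, smul_zero, add_zero, mul_zero] at h1
    rw [← h0, h2]
    nlinarith [mul_nonneg hlam.le (sq_nonneg b)]
  · refine le_of_mul_le_mul_left ?_ h0
    calc s * postVar k lam v x
        ≤ s * (‖u + b • r‖ ^ 2 + lam * ∑ j, (a j + b * a' j) ^ 2) :=
          mul_le_mul_of_nonneg_left h1 hs0
      _ = s * ‖u + b • r‖ ^ 2 + lam * (s * ∑ j, (a j + b * a' j) ^ 2) := by ring
      _ ≤ s * (1 + s) * ‖u‖ ^ 2 + (1 + s) * b ^ 2 * ‖r‖ ^ 2 +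
          lam * (s * (1 + s) * ∑ j, a j ^ 2 + (1 + s) * b ^ 2 * ∑ j, a' j ^ 2) :=
          add_le_add n1 (mul_le_mul_of_nonneg_left n2 hlam.le)
      _ = s * (1 + s) * (‖u‖ ^ 2 + lam * ∑ j, a j ^ 2) + (1 + s) * b ^ 2 * (s * lam) := by
          rw [h3]; ring
      _ = s * ((1 + s) * postVar k lam v' x) := by rw [h2]; ring

lemma one_add_smul_gram {ι : Type*} [DecidableEq ι] (hlam : 0 < lam) (v : ι → X) :
    1 + lam⁻¹ • gram k v = lam⁻¹ • (gram k v + lam • (1 : Matrix ι ι ℝ)) := by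
  rw [smul_add, smul_smul, inv_mul_cancel₀ hlam.ne', one_smul, add_comm]

lemma gainDet_pos (hk : IsFeatureMap φ k) (hlam : 0 < lam) (v : ι → X) :
    0 < gainDet k lam v := by
  rw [gainDet, one_add_smul_gram hlam]
  exact ((hk.posDef_gram_add hlam v).smul (inv_pos.2 hlam)).det_pos

/-- The Schur complement of the old block is the posterior variance of the new point, rescaled by λ
and shifted by one. -/
lemma gainDet_elim (hk : IsFeatureMap φ k) (hlam : 0 < lam) (v : ι → X) (y : X) :
    gainDet k lam (Sum.elim v fun _ : Unit => y) =
      gainDet k lam v * (1 + postVar k lam v y / lam) := by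
  set M := gram k v + lam • (1 : Matrix ι ι ℝ) with hM
  have hdet : IsUnit M.det := hk.isUnit_det_gram_add hlam v
  have hMi : (lam⁻¹ • M) * (lam • M⁻¹) = 1 := by
    rw [smul_mul_smul_comm, inv_mul_cancel₀ hlam.ne', one_smul, Matrix.mul_nonsing_inv _ hdet]
  have hiM : (lam • M⁻¹) * (lam⁻¹ • M) = 1 := by
    rw [smul_mul_smul_comm, mul_inv_cancel₀ hlam.ne', one_smul, Matrix.nonsing_inv_mul _ hdet]
  let _ : Invertible (lam⁻¹ • M) := ⟨lam • M⁻¹, hiM, hMi⟩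
  have hblock : 1 + lam⁻¹ • gram k (Sum.elim v fun _ : Unit => y) =
      Matrix.fromBlocks (lam⁻¹ • M) (lam⁻¹ • Matrix.replicateCol Unit (kvec k v y))
        (lam⁻¹ • Matrix.replicateRow Unit (kvec k v y))
        (Matrix.of fun _ _ => 1 + lam⁻¹ * k y y) := by
    rw [hM, ← one_add_smul_gram hlam]
    ext i j
    rcases i with i | i <;> rcases j with j | j <;>
      simp [gram, kvec, Matrix.one_apply, hk.symm y]
  rw [gainDet, hblock, Matrix.det_fromBlocks₁₁, gainDet, one_add_smul_gram hlam]
  congr 1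
  rw [Matrix.det_unique]
  change _ - (lam⁻¹ • Matrix.replicateRow Unit (kvec k v y) * (lam • M⁻¹) *
    (lam⁻¹ • Matrix.replicateCol Unit (kvec k v y))) _ _ = _
  rw [postVar, Matrix.mul_assoc]
  simp only [Matrix.smul_mul, Matrix.mul_smul, smul_smul, Matrix.smul_apply]
  have : (Matrix.replicateRow Unit (kvec k v y) *
      (M⁻¹ * Matrix.replicateCol Unit (kvec k v y))) default default =
      dotProduct (kvec k v y) (Matrix.mulVec M⁻¹ (kvec k v y)) := by
    simp [Matrix.mul_apply, Matrix.mulVec, dotProduct]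
  rw [this]
  simp only [Matrix.of_apply, smul_eq_mul]
  field_simp
  ring

lemma postVar_comp_equiv_le (hk : IsFeatureMap φ k) (hlam : 0 < lam) (v : ι → X) (e : κ ≃ ι)
    (x : X) : postVar k lam (v ∘ e) x ≤ postVar k lam v x := by
  rw [hk.postVar_eq hlam v]
  refine (hk.postVar_le hlam _ x (postWeights k lam v x ∘ e)).trans_eq ?_
  simp only [Function.comp_apply]
  rw [Equiv.sum_comp e fun i => postWeights k lam v x i • φ (v i),
    Equiv.sum_comp e fun i => postWeights k lam v x i ^ 2]

lemma postVar_comp_equiv (hk : IsFeatureMap φ k) (hlam : 0 < lam) (v : ι → X) (e : κ ≃ ι)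
    (x : X) : postVar k lam (v ∘ e) x = postVar k lam v x := by
  refine le_antisymm (hk.postVar_comp_equiv_le hlam v e x) ?_
  have := hk.postVar_comp_equiv_le hlam (v ∘ e) e.symm x
  rwa [Function.comp_assoc, Equiv.self_comp_symm, Function.comp_id] at this

end IsFeatureMap

lemma gainDet_comp_equiv (k : X → X → ℝ) (lam : ℝ) (v : ι → X) (e : κ ≃ ι) :
    gainDet k lam (v ∘ e) = gainDet k lam v := by
  rw [gainDet, gainDet, ← Matrix.det_submatrix_equiv_self e]
  congr 1
  ext i j
  simp [gram, Matrix.one_apply]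

/-- Sums over positions see only multiplicities. Summing over the support of the larger list puts
two lists on a common index set. -/
lemma sum_get_eq_sum_count [DecidableEq X] {M : Type*} [AddCommMonoid M] {p q : List X}
    (hpq : ∀ x, p.count x ≤ q.count x) (F : X → M) :
    ∑ i, F (p.get i) = ∑ z ∈ q.toFinset, p.count z • F z := by
  have hsub : p.toFinset ⊆ q.toFinset := fun z hz => by
    rw [List.mem_toFinset, ← List.count_pos_iff] at hz ⊢
    exact hz.trans_le (hpq z)
  have h : ∑ i, F (p.get i) = ∑ z ∈ p.toFinset, p.count z • F z := by
    rw [← Finset.sum_list_map_count, ← List.sum_ofFn]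
    congr 1
    exact List.ext_get (by simp) (by simp)
  rw [h]
  refine Finset.sum_subset hsub fun z _ hz => ?_
  rw [List.count_eq_zero_of_not_mem (by simpa using hz), zero_smul]

/-- The positions of `p ++ [y]` are those of `p` and one more. -/
def appendSingletonEquiv (p : List X) (y : X) : Fin p.length ⊕ Unit ≃ Fin (p ++ [y]).length :=
  ((Equiv.refl _).sumCongr (Equiv.ofUnique Unit (Fin 1))).trans
    (finSumFinEquiv.trans (finCongr (by simp)))

lemma get_comp_appendSingletonEquiv (p : List X) (y : X) :
    (p ++ [y]).get ∘ appendSingletonEquiv p y = Sum.elim p.get fun _ => y := by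
  ext i
  rcases i with i | i <;> simp [appendSingletonEquiv]

namespace IsFeatureMap

lemma gainDet_append (hk : IsFeatureMap φ k) (hlam : 0 < lam) (p : List X) (y : X) :
    gainDet k lam (p ++ [y]).get =
      gainDet k lam p.get * (1 + postVar k lam p.get y / lam) := by
  rw [← gainDet_comp_equiv k lam _ (appendSingletonEquiv p y), get_comp_appendSingletonEquiv,
    hk.gainDet_elim hlam]

/-- The factor is exactly the growth of `gainDet`, so determinant times variance is non-decreasing
along a growing list. -/
lemma postVar_le_append (hk : IsFeatureMap φ k) (hlam : 0 < lam) (p : List X) (x y : X) :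
    postVar k lam p.get x ≤ (1 + postVar k lam p.get y / lam) *
      postVar k lam (p ++ [y]).get x := by
  rw [← hk.postVar_comp_equiv hlam (p ++ [y]).get (appendSingletonEquiv p y),
    get_comp_appendSingletonEquiv]
  exact hk.postVar_elim_le hlam _ x y


/-- Further observations do not increase the posterior variance. -/
lemma postVar_anti [DecidableEq X] (hk : IsFeatureMap φ k) (hlam : 0 < lam) {p q : List X}
    (hpq : ∀ x, p.count x ≤ q.count x) (x : X) :
    postVar k lam q.get x ≤ postVar k lam p.get x := by
  obtain ⟨g, hg⟩ := hk.exists_postWeights_eq hlam p.get x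
  rw [hk.postVar_eq hlam p.get]
  -- The trial coefficients spread the total weight of each point in `p` evenly over its occurrences
  -- in `q`. The residual is unchanged, and the penalty p²g²/q is at most p g².
  refine (hk.postVar_le hlam _ x
    (fun i => (p.count (q.get i) : ℝ) * g (q.get i) / q.count (q.get i))).trans ?_
  simp only [hg]
  rw [sum_get_eq_sum_count (fun _ => le_rfl) fun z => ((p.count z : ℝ) * g z / q.count z) • φ z, sum_get_eq_sum_count hpq fun z => g z • φ z,
    sum_get_eq_sum_count (fun _ => le_rfl) fun z => ((p.count z : ℝ) * g z / q.count z) ^ 2, sum_get_eq_sum_count hpq fun z => g z ^ 2]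
  have hq : ∀ z ∈ q.toFinset, (0 : ℝ) < q.count z := fun z hz => by
    rw [List.mem_toFinset, ← List.count_pos_iff] at hz
    exact_mod_cast hz
  refine add_le_add (le_of_eq ?_) (mul_le_mul_of_nonneg_left ?_ hlam.le)
  · congr 3
    refine Finset.sum_congr rfl fun z hz => ?_
    have := hq z hz
    rw [← Nat.cast_smul_eq_nsmul ℝ, ← Nat.cast_smul_eq_nsmul ℝ, smul_smul, smul_smul]
    congr 1
    field_simp
  · refine Finset.sum_le_sum fun z hz => ?_
    have h1 := hq z hz
    have h2 : (p.count z : ℝ) ≤ q.count z := by exact_mod_cast hpq z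
    rw [nsmul_eq_mul, nsmul_eq_mul, div_pow, mul_pow, mul_div_assoc', div_le_iff₀ (by positivity)]
    have : (0 : ℝ) ≤ p.count z * q.count z * g z ^ 2 := by positivity
    nlinarith [mul_le_mul_of_nonneg_left h2 this]

end IsFeatureMap

end PosteriorTheory

end RGPPE

end

noncomputable section

namespace RGPPE

/-! ### Information gain and the size of the weights. -/

section SelectionLoop

variable {X H : Type*} [NormedAddCommGroup H] [InnerProductSpace ℝ H] {φ : X → H}
  {k : X → X → ℝ} {lam : ℝ}

/-- Bernoulli's inequality with an exponent in [0, 1]. It turns a posterior variance into an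
increment of the log-determinant. -/
lemma mul_log_one_add_inv_le {z : ℝ} (hlam : 0 < lam) (h0 : 0 ≤ z) (h1 : z ≤ 1) :
    z * Real.log (1 + lam⁻¹) ≤ Real.log (1 + z / lam) := by
  have hl : 0 < lam⁻¹ := inv_pos.2 hlam
  rw [← Real.log_rpow (by positivity)]
  refine Real.log_le_log (by positivity) ?_
  have := rpow_one_add_le_one_add_mul_self (s := lam⁻¹) (by linarith) h0 h1
  rwa [div_eq_mul_inv]

namespace IsFeatureMap

lemma gainDet_nil (k : X → X → ℝ) (lam : ℝ) : gainDet k lam ([] : List X).get = 1 := by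
  simp [gainDet]

lemma gainDet_le_append (hk : IsFeatureMap φ k) (hlam : 0 < lam) (p : List X) (y : X) :
    gainDet k lam p.get ≤ gainDet k lam (p ++ [y]).get := by
  rw [hk.gainDet_append hlam]
  have := div_nonneg (hk.postVar_nonneg hlam p.get y) hlam.le
  exact le_mul_of_one_le_right (hk.gainDet_pos hlam _).le (by linarith)

lemma log_gainDet_le_of_length_eq [Finite X] (k : X → X → ℝ) (lam : ℝ) (p : List X) :
    Real.log (gainDet k lam p.get) ≤ 2 * maxInfoGain k lam p.length := by
  have := le_ciSup (f := fun v : Fin p.length → X => (1 / 2) * Real.log (gainDet k lam v))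
    (Set.finite_range _).bddAbove p.get
  unfold maxInfoGain
  linarith

/-- The information gain of at most `T` points is at most `γ_T`. -/
lemma log_gainDet_le [Finite X] (hk : IsFeatureMap φ k) (hlam : 0 < lam) {T : ℕ} :
    ∀ (p : List X), p ≠ [] → p.length ≤ T →
      Real.log (gainDet k lam p.get) ≤ 2 * maxInfoGain k lam T := by
  suffices ∀ n (p : List X), p ≠ [] → p.length + n = T →
      Real.log (gainDet k lam p.get) ≤ 2 * maxInfoGain k lam T from
    fun p hp hT => this (T - p.length) p hp (by omega)
  intro n
  induction n with
  | zero =>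
    intro p _ hT
    rw [← hT, add_zero]
    exact log_gainDet_le_of_length_eq k lam p
  | succ n ih =>
    intro p hp hT
    -- A shorter list is padded with copies of its head; this is why it must not be empty.
    refine le_trans (Real.log_le_log (hk.gainDet_pos hlam _)
      (hk.gainDet_le_append hlam p (p.head hp))) (ih _ (by simp) ?_)
    simp only [List.length_append, List.length_singleton]
    omega

/-- Repeating one point `T` times gives a rank-one kernel matrix. A small information gain thus
forces a small kernel. -/
lemma log_one_add_mul_le_maxInfoGain [Finite X] (k : X → X → ℝ) (lam : ℝ) (T : ℕ)
    (x : X) : Real.log (1 + T * k x x / lam) ≤ 2 * maxInfoGain k lam T := by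
  have h := le_ciSup (f := fun v : Fin T → X => (1 / 2) * Real.log (gainDet k lam v))
    (Set.finite_range _).bddAbove fun _ => x
  have e : gainDet k lam (fun _ : Fin T => x) = 1 + T * k x x / lam := by
    have : lam⁻¹ • gram k (fun _ : Fin T => x) =
        Matrix.replicateCol Unit (fun _ : Fin T => k x x / lam) *
          Matrix.replicateRow Unit (fun _ : Fin T => (1 : ℝ)) := by
      ext i j
      simp [gram, Matrix.mul_apply, div_eq_inv_mul]
    rw [gainDet, this, Matrix.det_one_add_replicateCol_mul_replicateRow]
    simp [dotProduct, mul_div_assoc]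
  simp only [e] at h
  unfold maxInfoGain
  linarith

/-- A point that is observed often has small weights. -/
lemma abs_postWeights_le [DecidableEq X] (hk : IsFeatureMap φ k) (hlam : 0 < lam) {p : List X}
    {m : ℝ} (hm : 0 < m) (hp : ∀ z ∈ p, m ≤ p.count z) (x : X) (i : Fin p.length) :
    |postWeights k lam p.get x i| ≤ postStd k lam p.get x / Real.sqrt (lam * m) := by
  obtain ⟨g, hg⟩ := hk.exists_postWeights_eq hlam p.get x
  have h1 := hk.sum_sq_postWeights_le hlam p.get x
  simp only [hg] at h1 ⊢
  rw [sum_get_eq_sum_count (fun _ => le_rfl) fun z => g z ^ 2] at h1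
  -- All occurrences of one point share its weight, so this point alone contributes its count times
  -- the square.
  have h2 : p.count (p.get i) • g (p.get i) ^ 2 ≤ ∑ z ∈ p.toFinset, p.count z • g z ^ 2 :=
    Finset.single_le_sum (f := fun z => p.count z • g z ^ 2) (fun z _ => by positivity)
      (by simp)
  have h3 : m * g (p.get i) ^ 2 ≤ p.count (p.get i) • g (p.get i) ^ 2 := by
    rw [nsmul_eq_mul]
    exact mul_le_mul_of_nonneg_right (hp _ (List.get_mem _ _)) (sq_nonneg _)
  have h4 : lam * m * g (p.get i) ^ 2 ≤ postVar k lam p.get x := by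
    refine le_trans ?_ h1
    rw [mul_assoc]
    exact mul_le_mul_of_nonneg_left (h3.trans h2) hlam.le
  rw [le_div_iff₀ (by positivity), ← Real.sqrt_sq_eq_abs, ← Real.sqrt_mul (sq_nonneg _)]
  exact Real.sqrt_le_sqrt (by linarith)

end IsFeatureMap

/-! ### Rare switching: few distinct points, small remaining variance. -/

namespace Config

variable (cfg : Config X)

/-- What the selection loop of an epoch preserves. -/
structure LoopInvariant [DecidableEq X] (h : ℕ) (A : Finset X) (s : List X × List X) (t : ℕ) :
    Prop where
  count_le : ∀ x, s.2.count x ≤ s.1.count x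
  gainDet_le : gainDet cfg.k cfg.lam s.1.get ≤ cfg.eta * gainDet cfg.k cfg.lam s.2.get
  gainDet_mul_postVar_le : ∀ x, gainDet cfg.k cfg.lam s.2.get * postVar cfg.k cfg.lam s.2.get x ≤
    gainDet cfg.k cfg.lam s.1.get * postVar cfg.k cfg.lam s.1.get x
  mul_postVar_le : ∀ x ∈ A, t * postVar cfg.k cfg.lam s.1.get x * Real.log (1 + cfg.lam⁻¹) ≤
    cfg.eta * Real.log (gainDet cfg.k cfg.lam s.1.get)
  card_le : ∃ J : ℕ, cfg.eta ^ J ≤ gainDet cfg.k cfg.lam s.2.get ∧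
    (insert (cfg.rule.select h A (postStd cfg.k cfg.lam s.2.get)) s.1.toFinset).card ≤ J + 1

variable {cfg} [DecidableEq X]

lemma loopInvariant_init (heta : 1 ≤ cfg.eta) (h : ℕ) (A : Finset X) :
    cfg.LoopInvariant h A ([], []) 0 where
  count_le _ := le_rfl
  gainDet_le := by simp only [IsFeatureMap.gainDet_nil, mul_one]; exact heta
  gainDet_mul_postVar_le _ := le_rfl
  mul_postVar_le x _ := by
    simp only [IsFeatureMap.gainDet_nil, Real.log_one]
    simp
  card_le := ⟨0, by rw [pow_zero, IsFeatureMap.gainDet_nil], by simp⟩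

/-- The number `J` counts switches. Until the next switch the selection sees the same function and
returns the same point, so including that point in the count in advance leaves it unchanged; a
switch adds at most one point and multiplies the determinant of the initial segment by more than
`eta`. -/
lemma LoopInvariant.step (hk : IsFeatureMap φ cfg.k) (hk1 : ∀ x, cfg.k x x ≤ 1)
    (hlam : 0 < cfg.lam) (heta : 1 ≤ cfg.eta) {h : ℕ} {A : Finset X} {s : List X × List X} {t : ℕ}
    (hs : cfg.LoopInvariant h A s t) : cfg.LoopInvariant h A (cfg.loopStep h A s) (t + 1) := by
  obtain ⟨p, q⟩ := s
  set y := cfg.rule.select h A (postStd cfg.k cfg.lam q.get) with hy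
  obtain ⟨h3, h4, h5, h6, J, h7, h8⟩ := hs
  simp only at h3 h4 h5 h6 h7 h8
  rw [← hy] at h8
  have hdp := hk.gainDet_pos hlam p.get
  have hdq := hk.gainDet_pos hlam q.get
  have hcount : ∀ x, p.count x ≤ (p ++ [y]).count x := fun x => by simp
  -- The point `y` maximizes the stale variance; passing from `q` to `p` shrinks its variance by at
  -- most the determinant ratio, hence by at most `eta`.
  have hvar : ∀ x ∈ A, postVar cfg.k cfg.lam p.get x ≤
      cfg.eta * postVar cfg.k cfg.lam p.get y := by
    intro x hx
    have a1 : postVar cfg.k cfg.lam q.get x ≤ postVar cfg.k cfg.lam q.get y := by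
      rw [← hk.sq_postStd hlam, ← hk.sq_postStd hlam]
      exact pow_le_pow_left₀ (Real.sqrt_nonneg _)
        (cfg.rule.le_select h A (postStd cfg.k cfg.lam q.get) x hx) 2
    have a2 : gainDet cfg.k cfg.lam q.get * postVar cfg.k cfg.lam q.get y ≤
        gainDet cfg.k cfg.lam q.get * (cfg.eta * postVar cfg.k cfg.lam p.get y) := by
      refine (h5 y).trans ((mul_le_mul_of_nonneg_right h4 (hk.postVar_nonneg hlam _ _)).trans_eq ?_)
      ring
    exact (hk.postVar_anti hlam h3 x).trans (a1.trans (le_of_mul_le_mul_left a2 hdq))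
  -- The potential argument: each selection adds to the log-determinant at least the current
  -- variance at `x`, up to `eta` and the logarithmic factor, and later variances at `x` are
  -- smaller.
  have hsum : ∀ x ∈ A, ((t + 1 : ℕ) : ℝ) * postVar cfg.k cfg.lam (p ++ [y]).get x *
      Real.log (1 + cfg.lam⁻¹) ≤ cfg.eta * Real.log (gainDet cfg.k cfg.lam (p ++ [y]).get) := by
    intro x hx
    have hv0 := hk.postVar_nonneg hlam p.get y
    have hfac : (0 : ℝ) < 1 + postVar cfg.k cfg.lam p.get y / cfg.lam := by positivity
    have hL : 0 ≤ Real.log (1 + cfg.lam⁻¹) :=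
      Real.log_nonneg (by have := inv_pos.2 hlam; linarith)
    have b1 := mul_log_one_add_inv_le hlam hv0 ((hk.postVar_le_self hlam p.get y).trans (hk1 y))
    rw [hk.gainDet_append hlam, Real.log_mul hdp.ne' hfac.ne', mul_add]
    calc ((t + 1 : ℕ) : ℝ) * postVar cfg.k cfg.lam (p ++ [y]).get x * Real.log (1 + cfg.lam⁻¹)
        ≤ ((t + 1 : ℕ) : ℝ) * postVar cfg.k cfg.lam p.get x * Real.log (1 + cfg.lam⁻¹) := by
          gcongr
          exact hk.postVar_anti hlam hcount x
      _ = t * postVar cfg.k cfg.lam p.get x * Real.log (1 + cfg.lam⁻¹) +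
          postVar cfg.k cfg.lam p.get x * Real.log (1 + cfg.lam⁻¹) := by push_cast; ring
      _ ≤ _ := by
          refine add_le_add (h6 x hx) ?_
          calc _ ≤ cfg.eta * postVar cfg.k cfg.lam p.get y * Real.log (1 + cfg.lam⁻¹) :=
                mul_le_mul_of_nonneg_right (hvar x hx) hL
            _ ≤ _ := by
                rw [mul_assoc]
                exact mul_le_mul_of_nonneg_left b1 (by linarith)
  have htf : (p ++ [y]).toFinset = insert y p.toFinset := by
    ext z; simp [or_comm]
  rw [loopStep]
  simp only [← hy]
  split_ifs with hsw
  · refine ⟨fun _ => le_rfl, ?_, fun _ => le_rfl, hsum, J + 1, ?_, ?_⟩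
    · exact le_mul_of_one_le_left (hk.gainDet_pos hlam _).le heta
    · refine le_trans ?_ hsw.le
      rw [pow_succ']
      exact mul_le_mul_of_nonneg_left h7 (by linarith)
    · simp only [htf]
      exact (Finset.card_insert_le _ _).trans (by omega)
  · refine ⟨fun x => (h3 x).trans (hcount x), not_lt.1 hsw, fun x => ?_, hsum,
      J, h7, ?_⟩
    · refine (h5 x).trans ?_
      rw [hk.gainDet_append hlam, mul_assoc]
      exact mul_le_mul_of_nonneg_left (hk.postVar_le_append hlam p x y) hdp.le
    · simp only [htf, ← hy]
      rwa [Finset.insert_idem]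

lemma loopInvariant_iterate (hk : IsFeatureMap φ cfg.k) (hk1 : ∀ x, cfg.k x x ≤ 1)
    (hlam : 0 < cfg.lam) (heta : 1 ≤ cfg.eta) (h : ℕ) (A : Finset X) (t : ℕ) :
    cfg.LoopInvariant h A ((cfg.loopStep h A)^[t] ([], [])) t := by
  induction t with
  | zero => exact loopInvariant_init heta h A
  | succ t ih =>
    rw [Function.iterate_succ_apply']
    exact ih.step hk hk1 hlam heta

lemma length_loopPoints {X : Type*} (cfg : Config X) (h : ℕ) (A : Finset X) :
    (cfg.loopPoints h A).length = len h := by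
  have : ∀ t, ((cfg.loopStep h A)^[t] ([], [])).1.length = t := by
    intro t
    induction t with
    | zero => rfl
    | succ t ih =>
      rw [Function.iterate_succ_apply', loopStep]
      split_ifs <;> simp [ih]
  exact this _

lemma mem_of_mem_loopPoints {X : Type*} (cfg : Config X) {h : ℕ} {A : Finset X} (hA : A.Nonempty) {x : X}
    (hx : x ∈ cfg.loopPoints h A) : x ∈ A := by
  have : ∀ t, ∀ x ∈ ((cfg.loopStep h A)^[t] ([], [])).1, x ∈ A := by
    intro t
    induction t with
    | zero => simp
    | succ t ih =>
      rw [Function.iterate_succ_apply', loopStep]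
      have : ∀ x ∈ ((cfg.loopStep h A)^[t] ([], [])).1 ++ [cfg.rule.select h A
          (postStd cfg.k cfg.lam ((cfg.loopStep h A)^[t] ([], [])).2.get)], x ∈ A := by
        intro x hx
        rcases List.mem_append.1 hx with hx | hx
        · exact ih x hx
        · rw [List.mem_singleton.1 hx]
          exact cfg.rule.select_mem h A _ hA
      split_ifs
      · exact this
      · exact this
  exact this _ x hx

lemma count_epochPlays (cfg : Config X) (h : ℕ) (A : Finset X) (x : X) :
    (cfg.epochPlays h A).count x =
      if x ∈ cfg.loopPoints h A then cfg.numPlays h A x else 0 := by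
  rw [← Multiset.coe_count, epochPlays, cfg.rule.coe_arrange, Multiset.count_sum']
  simp only [Multiset.count_replicate]
  simp [Finset.sum_ite_eq, eq_comm]

lemma mem_epochPlays {cfg : Config X} {h : ℕ} {A : Finset X} {x : X}
    (hx : x ∈ cfg.epochPlays h A) : x ∈ cfg.loopPoints h A := by
  by_contra hn
  have := cfg.count_epochPlays h A x
  rw [if_neg hn, List.count_eq_zero] at this
  exact this hx

lemma length_epochPlays (cfg : Config X) (h : ℕ) (A : Finset X) :
    (cfg.epochPlays h A).length =
      ∑ x ∈ (cfg.loopPoints h A).toFinset, cfg.numPlays h A x := by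
  rw [← Multiset.coe_card, epochPlays, cfg.rule.coe_arrange]
  simp

lemma len_pos (h : ℕ) : 0 < len h := by unfold len; positivity

lemma count_loopPoints_le_numPlays (cfg : Config X) (h : ℕ) (A : Finset X) (x : X) :
    (cfg.loopPoints h A).count x ≤ cfg.numPlays h A x := by
  have hl : (0 : ℝ) < len h := by exact_mod_cast len_pos h
  have : ((cfg.loopPoints h A).count x : ℝ) ≤ (cfg.numPlays h A x : ℝ) := by
    refine le_trans ?_ (Nat.le_ceil _)
    calc ((cfg.loopPoints h A).count x : ℝ) = len h * cfg.freq h A x := by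
          rw [freq, mul_div_cancel₀ _ hl.ne']
      _ ≤ _ := mul_le_mul_of_nonneg_left (le_max_left _ _) hl.le
  exact_mod_cast this

lemma count_loopPoints_le (cfg : Config X) (h : ℕ) (A : Finset X) (x : X) :
    (cfg.loopPoints h A).count x ≤ (cfg.epochPlays h A).count x := by
  rw [count_epochPlays]
  split_ifs with hx
  · exact cfg.count_loopPoints_le_numPlays h A x
  · rw [List.count_eq_zero_of_not_mem hx]

lemma len_mul_psi_le_count {cfg : Config X} {h : ℕ} {A : Finset X} {x : X}
    (hx : x ∈ cfg.epochPlays h A) : len h * cfg.psi ≤ (cfg.epochPlays h A).count x := by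
  rw [count_epochPlays, if_pos (mem_epochPlays hx)]
  refine le_trans ?_ (Nat.le_ceil _)
  exact mul_le_mul_of_nonneg_left (le_max_right _ _) (Nat.cast_nonneg _)

lemma sum_count_loopPoints (cfg : Config X) (h : ℕ) (A : Finset X) :
    ∑ x ∈ (cfg.loopPoints h A).toFinset, (cfg.loopPoints h A).count x = len h := by
  rw [← cfg.length_loopPoints h A, List.sum_toFinset_count_eq_length]

lemma len_le_length_epochPlays (cfg : Config X) (h : ℕ) (A : Finset X) :
    len h ≤ (cfg.epochPlays h A).length := by
  rw [length_epochPlays, ← cfg.sum_count_loopPoints h A]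
  exact Finset.sum_le_sum fun x _ => cfg.count_loopPoints_le_numPlays h A x

lemma card_toFinset_loopPoints_le (cfg : Config X) (h : ℕ) (A : Finset X) :
    (cfg.loopPoints h A).toFinset.card ≤ len h :=
  (List.toFinset_card_le _).trans_eq (cfg.length_loopPoints h A)

/-- A crude bound without the condition `len h ≤ T`, for the initial epoch, which may be longer than
the run. -/
lemma length_epochPlays_le_sq {cfg : Config X} (hpsi : cfg.psi ≤ 1) (h : ℕ) (A : Finset X) :
    (cfg.epochPlays h A).length ≤ len h * len h := by
  rw [length_epochPlays]
  refine (Finset.sum_le_card_nsmul _ _ (len h) fun x _ => ?_).trans ?_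
  · have hl : (0 : ℝ) < len h := by exact_mod_cast len_pos h
    refine Nat.ceil_le.2 (mul_le_of_le_one_right hl.le (max_le ?_ hpsi))
    rw [freq, div_le_one hl, ← cfg.length_loopPoints h A]
    exact_mod_cast List.count_le_length (a := x) (l := cfg.loopPoints h A)
  · rw [smul_eq_mul]
    exact Nat.mul_le_mul_right _ (cfg.card_toFinset_loopPoints_le h A)

lemma length_epochPlays_le [Finite X] (hk : IsFeatureMap φ cfg.k) (hk1 : ∀ x, cfg.k x x ≤ 1)
    (hlam : 0 < cfg.lam) (heta : 1 < cfg.eta) {T : ℕ}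
    (hpsi : cfg.psi = Real.log cfg.eta / (2 * maxInfoGain cfg.k cfg.lam T))
    (hpsi0 : 0 < cfg.psi) (hpsi1 : cfg.psi ≤ 1) {h : ℕ} (hT : len h ≤ T) (A : Finset X) :
    (cfg.epochPlays h A).length ≤ 4 * len h := by
  have hinv := loopInvariant_iterate hk hk1 hlam heta.le h A (len h)
  obtain ⟨J, hJ1, hJ2⟩ := hinv.card_le
  have hl : (0 : ℝ) < len h := by exact_mod_cast len_pos h
  have hcard : (cfg.loopPoints h A).toFinset.card ≤ J + 1 :=
    (Finset.card_le_card (Finset.subset_insert _ _)).trans hJ2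
  set q := ((cfg.loopStep h A)^[len h] ([], [])).2 with hq
  -- The `J` switches give `eta ^ J` at most the determinant, hence J log η ≤ 2γ_T, and ψ is the
  -- reciprocal of 2γ_T / log η.
  have hJ : J * cfg.psi ≤ 1 := by
    have hlogη := Real.log_pos heta
    have hγ : 0 < 2 * maxInfoGain cfg.k cfg.lam T := by
      by_contra hn
      rw [hpsi] at hpsi0
      exact absurd hpsi0 (not_lt.2 (div_nonpos_of_nonneg_of_nonpos hlogη.le (not_lt.1 hn)))
    have hqlen : q.length ≤ T := by
      refine le_trans ?_ hT
      rw [← cfg.length_loopPoints h A, ← List.sum_toFinset_count_eq_length q]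
      calc ∑ x ∈ q.toFinset, q.count x ≤ ∑ x ∈ q.toFinset, (cfg.loopPoints h A).count x :=
            Finset.sum_le_sum fun x _ => hinv.count_le x
        _ ≤ ∑ x ∈ (cfg.loopPoints h A).toFinset, (cfg.loopPoints h A).count x := by
            refine Finset.sum_le_sum_of_subset fun x hx => ?_
            rw [List.mem_toFinset, ← List.count_pos_iff] at hx ⊢
            exact hx.trans_le (hinv.count_le x)
        _ = _ := List.sum_toFinset_count_eq_length _
    have hlog : J * Real.log cfg.eta ≤ 2 * maxInfoGain cfg.k cfg.lam T := by
      rcases eq_or_ne q [] with h0 | h0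
      · rw [h0, IsFeatureMap.gainDet_nil] at hJ1
        rw [← Real.log_pow]
        exact (Real.log_nonpos (by positivity) hJ1).trans hγ.le
      · rw [← Real.log_pow]
        exact (Real.log_le_log (by positivity) hJ1).trans (hk.log_gainDet_le hlam q h0 hqlen)
    rw [hpsi, mul_div_assoc', div_le_one hγ]
    exact hlog
  have hcard' : ((cfg.loopPoints h A).toFinset.card : ℝ) * cfg.psi ≤ 2 := by
    have : ((cfg.loopPoints h A).toFinset.card : ℝ) ≤ J + 1 := by exact_mod_cast hcard
    nlinarith
  have hcard'' : ((cfg.loopPoints h A).toFinset.card : ℝ) ≤ len h := by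
    exact_mod_cast cfg.card_toFinset_loopPoints_le h A
  have hsum : (∑ x ∈ (cfg.loopPoints h A).toFinset, ((cfg.loopPoints h A).count x : ℝ)) = len h := by
    exact_mod_cast cfg.sum_count_loopPoints h A
  have : ((cfg.epochPlays h A).length : ℝ) ≤ 4 * len h := by
    rw [length_epochPlays, Nat.cast_sum]
    -- The factor 4: one from the frequencies, at most two from the truncation, at most one from
    -- rounding up.
    calc ∑ x ∈ (cfg.loopPoints h A).toFinset, (cfg.numPlays h A x : ℝ)
        ≤ ∑ x ∈ (cfg.loopPoints h A).toFinset,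
            (((cfg.loopPoints h A).count x : ℝ) + len h * cfg.psi + 1) := by
          refine Finset.sum_le_sum fun x _ => ?_
          have hf : 0 ≤ cfg.freq h A x := by unfold freq; positivity
          refine (Nat.ceil_lt_add_one (mul_nonneg hl.le (le_max_of_le_left hf))).le.trans ?_
          have : max (cfg.freq h A x) cfg.psi ≤ cfg.freq h A x + cfg.psi :=
            max_le (by linarith) (by linarith)
          have e : ((cfg.loopPoints h A).count x : ℝ) = len h * cfg.freq h A x := by
            rw [freq, mul_div_cancel₀ _ hl.ne']
          rw [e, ← mul_add]
          have := mul_le_mul_of_nonneg_left this hl.le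
          linarith
      _ = len h + (cfg.loopPoints h A).toFinset.card * cfg.psi * len h +
          (cfg.loopPoints h A).toFinset.card := by
          rw [Finset.sum_add_distrib, Finset.sum_add_distrib, hsum]
          simp only [Finset.sum_const, nsmul_eq_mul, mul_one]
          ring
      _ ≤ 4 * len h := by nlinarith
  exact_mod_cast this

/-- The uncertainty that is left at the end of an epoch. -/
lemma len_mul_postVar_epochPlays_le [Finite X] (hk : IsFeatureMap φ cfg.k)
    (hk1 : ∀ x, cfg.k x x ≤ 1) (hlam : 0 < cfg.lam) (heta : 1 ≤ cfg.eta) {h T : ℕ}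
    (hT : len h ≤ T) {A : Finset X} {x : X} (hx : x ∈ A) :
    len h * postVar cfg.k cfg.lam (cfg.epochPlays h A).get x * Real.log (1 + cfg.lam⁻¹) ≤
      cfg.eta * (2 * maxInfoGain cfg.k cfg.lam T) := by
  have hinv := loopInvariant_iterate hk hk1 hlam heta h A (len h)
  have hL : 0 ≤ Real.log (1 + cfg.lam⁻¹) :=
    Real.log_nonneg (by have := inv_pos.2 hlam; linarith)
  have hlen := cfg.length_loopPoints h A
  calc _ ≤ len h * postVar cfg.k cfg.lam (cfg.loopPoints h A).get x *
        Real.log (1 + cfg.lam⁻¹) := by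
        gcongr
        exact hk.postVar_anti hlam (cfg.count_loopPoints_le h A) x
    _ ≤ cfg.eta * Real.log (gainDet cfg.k cfg.lam (cfg.loopPoints h A).get) :=
        hinv.mul_postVar_le x hx
    _ ≤ _ := by
        refine mul_le_mul_of_nonneg_left ?_ (by linarith)
        refine hk.log_gainDet_le hlam _ ?_ (hlen.trans_le hT)
        intro h0
        rw [h0] at hlen
        exact (len_pos h).ne hlen

end Config

end SelectionLoop

end RGPPE

end

noncomputable section

namespace RGPPE

open MeasureTheory ProbabilityTheory

/-! ### Chernoff bounds for a block of noise. -/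

section Noise

variable {Ω : Type*} [mΩ : MeasurableSpace Ω] {μ : Measure Ω}
  {ℱ : Filtration ℕ mΩ} {σ : ℝ≥0} {C : ℝ} {T : ℕ} {ε c : ℕ → Ω → ℝ}

lemma measurable_le_filtration {e : ℕ → Ω → ℝ} (he : ∀ t, Measurable[ℱ (t + 1)] (e t))
    {s t : ℕ} (hst : s < t) : Measurable[ℱ t] (e s) :=
  (he s).mono (ℱ.mono hst) le_rfl

/-- The moment generating function of a block of noise, on an event that precedes the block. -/
lemma IsCorruptedNoise.setLIntegral_exp_le (hN : IsCorruptedNoise μ ℱ σ C T ε c) {τ : ℕ}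
    {E : Set Ω} (hE : MeasurableSet[ℱ τ] E) (s : ℝ) :
    ∀ (n : ℕ) (a : Fin n → ℝ),
      ∫⁻ ω in E, ENNReal.ofReal (Real.exp (s * ∑ j, a j * ε (τ + j) ω)) ∂μ ≤
        ENNReal.ofReal (Real.exp (s ^ 2 * ((σ : ℝ) ^ 2 * ∑ j, a j ^ 2) / 2)) * μ E := by
  intro n
  induction n with
  | zero => intro a; simp
  | succ n ih =>
    intro a
    have hEm : MeasurableSet E := ℱ.le _ _ hE
    -- The last noise term is split off. All earlier factors, with the indicator of `E`, are known
    -- before its round, so the integral factorizes.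
    set F : Ω → ENNReal := E.indicator fun ω =>
      ENNReal.ofReal (Real.exp (s * ∑ j : Fin n, a j.castSucc * ε (τ + j) ω)) with hF
    set G : Ω → ENNReal := fun ω =>
      ENNReal.ofReal (Real.exp (s * a (Fin.last n) * ε (τ + n) ω)) with hG
    have hFm : Measurable[ℱ (τ + n)] F := by
      refine Measurable.indicator ?_ (ℱ.mono (Nat.le_add_right τ n) _ hE)
      refine ENNReal.measurable_ofReal.comp (Real.measurable_exp.comp ?_)
      refine Measurable.const_mul (Finset.measurable_fun_sum _ fun j _ => ?_) s
      exact (measurable_le_filtration hN.measurable_noise (by omega)).const_mul _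
    have hGm : Measurable[MeasurableSpace.comap (ε (τ + n)) inferInstance] G := by
      refine ENNReal.measurable_ofReal.comp (Real.measurable_exp.comp ?_)
      exact (comap_measurable _).const_mul _
    have hεm : Measurable (ε (τ + n)) := (hN.measurable_noise _).mono (ℱ.le _) le_rfl
    have hind := lintegral_mul_eq_lintegral_mul_lintegral_of_independent_measurableSpace
      (ℱ.le (τ + n)) hεm.comap_le (hN.indep_noise (τ + n)).symm hFm hGm
    have hGle : ∫⁻ ω, G ω ∂μ ≤
        ENNReal.ofReal (Real.exp ((σ : ℝ) ^ 2 * (s * a (Fin.last n)) ^ 2 / 2)) := by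
      have hsub := hN.subgaussian_noise (τ + n)
      rw [hG, ← ofReal_integral_eq_lintegral_ofReal (hsub.integrable_exp_mul _)
        (Filter.Eventually.of_forall fun ω => (Real.exp_pos _).le)]
      refine ENNReal.ofReal_le_ofReal ?_
      have := hsub.mgf_le (s * a (Fin.last n))
      rw [mgf] at this
      simpa using this
    have hFle := ih fun j => a j.castSucc
    rw [← lintegral_indicator hEm] at hFle ⊢
    calc _ = ∫⁻ ω, F ω * G ω ∂μ := by
          refine lintegral_congr fun ω => ?_
          simp only [hF, hG]
          by_cases hω : ω ∈ E
          · rw [Set.indicator_of_mem hω, Set.indicator_of_mem hω, ← ENNReal.ofReal_mul (Real.exp_pos _).le, ← Real.exp_add, Fin.sum_univ_castSucc]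
            congr 2
            simp only [Fin.val_castSucc, Fin.val_last]
            ring
          · simp [hω]
      _ = (∫⁻ ω, F ω ∂μ) * ∫⁻ ω, G ω ∂μ := hind
      _ ≤ _ := mul_le_mul' hFle hGle
      _ = _ := by
          rw [mul_right_comm, ← ENNReal.ofReal_mul (Real.exp_pos _).le, ← Real.exp_add,
            Fin.sum_univ_castSucc]
          congr 3
          ring

/-- Tail bound for a block of noise, on an event that precedes the block. -/
lemma IsCorruptedNoise.measure_inter_lt_sum_le (hN : IsCorruptedNoise μ ℱ σ C T ε c) {τ n : ℕ}
    {E : Set Ω} (hE : MeasurableSet[ℱ τ] E) (a : Fin n → ℝ) {r L : ℝ} (hr : 0 ≤ r) (hL : 0 ≤ L)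
    (ha : (σ : ℝ) ^ 2 * ∑ j, a j ^ 2 ≤ r ^ 2) :
    μ (E ∩ {ω | r * Real.sqrt (2 * L) < ∑ j, a j * ε (τ + j) ω}) ≤
      ENNReal.ofReal (Real.exp (-L)) * μ E := by
  have hEm : MeasurableSet E := ℱ.le _ _ hE
  -- For `r = 0` the Chernoff parameter √(2L)/r is meaningless, but then σ or all weights vanish and
  -- the sum is almost surely zero.
  rcases hr.eq_or_lt with h0 | h0
  · have hz : ∀ᵐ ω ∂μ, ∑ j, a j * ε (τ + j) ω = 0 := by
      have hpos : 0 ≤ ∑ j, a j ^ 2 := Finset.sum_nonneg fun j _ => sq_nonneg _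
      have hprod : (σ : ℝ) ^ 2 * ∑ j, a j ^ 2 = 0 := by
        refine le_antisymm (ha.trans (by rw [← h0]; norm_num)) (by positivity)
      rcases mul_eq_zero.1 hprod with h | h
      · have hσ : σ ^ 2 = 0 := by exact_mod_cast h
        have hall : ∀ᵐ ω ∂μ, ∀ t, ε t ω = 0 := by
          rw [ae_all_iff]
          intro t
          have := hN.subgaussian_noise t
          rw [hσ] at this
          exact this.ae_eq_zero_of_hasSubgaussianMGF_zero
        filter_upwards [hall] with ω hω
        simp [hω]
      · refine Filter.Eventually.of_forall fun ω => Finset.sum_eq_zero fun j _ => ?_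
        have := (Finset.sum_eq_zero_iff_of_nonneg fun j _ => sq_nonneg (a j)).1 h j
          (Finset.mem_univ _)
        rw [pow_eq_zero_iff two_ne_zero |>.1 this, zero_mul]
    have : μ (E ∩ {ω | r * Real.sqrt (2 * L) < ∑ j, a j * ε (τ + j) ω}) = 0 := by
      refine measure_mono_null Set.inter_subset_right (measure_mono_null (fun ω hω => ?_) hz)
      simp only [Set.mem_ofPred_eq, ← h0, zero_mul] at hω
      exact hω.ne'
    rw [this]
    exact zero_le
  · set s := Real.sqrt (2 * L) / r with hs
    set Z : Ω → ℝ := fun ω => ∑ j, a j * ε (τ + j) ω with hZ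
    have hs0 : 0 ≤ s := by positivity
    have hsq : Real.sqrt (2 * L) ^ 2 = 2 * L := Real.sq_sqrt (by positivity)
    have h1 := hN.setLIntegral_exp_le hE s n a
    have hZm : Measurable Z := Finset.measurable_fun_sum _ fun j _ =>
      ((hN.measurable_noise _).mono (ℱ.le _) le_rfl).const_mul _
    -- Markov at level exp(2L): the threshold times `s` is 2L, while the moment generating function
    -- is at most exp(L).
    have h2 := mul_meas_ge_le_lintegral (μ := μ.restrict E)
      (f := fun ω => ENNReal.ofReal (Real.exp (s * Z ω)))
      (by fun_prop) (ENNReal.ofReal (Real.exp (2 * L)))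
    have h3 : s ^ 2 * ((σ : ℝ) ^ 2 * ∑ j, a j ^ 2) / 2 ≤ L := by
      have : s ^ 2 * r ^ 2 = 2 * L := by rw [hs, div_pow, hsq]; field_simp
      nlinarith [mul_le_mul_of_nonneg_left ha (sq_nonneg s)]
    have h4 : ENNReal.ofReal (Real.exp (2 * L)) *
        μ (E ∩ {ω | r * Real.sqrt (2 * L) < Z ω}) ≤ ENNReal.ofReal (Real.exp L) * μ E := by
      refine le_trans ?_ (h2.trans (h1.trans ?_))
      · refine mul_le_mul_right ?_ _
        rw [Measure.restrict_apply' hEm]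
        refine measure_mono fun ω hω => ⟨?_, hω.1⟩
        refine ENNReal.ofReal_le_ofReal (Real.exp_le_exp.2 ?_)
        have : r * Real.sqrt (2 * L) ≤ Z ω := hω.2.le
        calc 2 * L = s * (r * Real.sqrt (2 * L)) := by
              rw [hs]; field_simp; exact hsq.symm
          _ ≤ _ := mul_le_mul_of_nonneg_left this hs0
      · exact mul_le_mul_left (ENNReal.ofReal_le_ofReal (Real.exp_le_exp.2 h3)) _
    calc μ (E ∩ {ω | r * Real.sqrt (2 * L) < Z ω})
        = ENNReal.ofReal (Real.exp (-(2 * L))) * (ENNReal.ofReal (Real.exp (2 * L)) *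
            μ (E ∩ {ω | r * Real.sqrt (2 * L) < Z ω})) := by
          rw [← mul_assoc, ← ENNReal.ofReal_mul (Real.exp_pos _).le, ← Real.exp_add]
          simp
      _ ≤ ENNReal.ofReal (Real.exp (-(2 * L))) * (ENNReal.ofReal (Real.exp L) * μ E) :=
          mul_le_mul_right h4 _
      _ = _ := by
          rw [← mul_assoc, ← ENNReal.ofReal_mul (Real.exp_pos _).le, ← Real.exp_add]
          congr 3
          ring

end Noise

/-! ### Epoch starts as stopping times. -/

section Adaptivity

variable {X : Type*} [DecidableEq X] (cfg : Config X)

lemma Config.mem_eliminate {h : ℕ} {A : Finset X} {y : Fin (cfg.epochPlays h A).length → ℝ}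
    {x : X} : x ∈ cfg.eliminate h A y ↔ x ∈ A ∧ ∀ z ∈ A,
      robustMean cfg.k cfg.lam (cfg.epochPlays h A).get y z - cfg.width h A z ≤
        robustMean cfg.k cfg.lam (cfg.epochPlays h A).get y x + cfg.width h A x := by
  simp only [Config.eliminate, Finset.mem_filter]

lemma Config.measurableSet_eliminate_eq [Finite X] (h : ℕ) (A A' : Finset X) :
    MeasurableSet {y | cfg.eliminate h A y = A'} := by
  have hm : ∀ x, Measurable fun y : Fin (cfg.epochPlays h A).length → ℝ =>
      robustMean cfg.k cfg.lam (cfg.epochPlays h A).get y x := by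
    intro x
    unfold robustMean postMean avgObs dotProduct Matrix.mulVec dotProduct
    refine Finset.measurable_fun_sum _ fun i _ => Measurable.const_mul ?_ _
    refine Finset.measurable_fun_sum _ fun j _ => Measurable.const_mul (Measurable.div_const ?_ _) _
    refine Finset.measurable_fun_sum _ fun l _ => ?_
    split_ifs
    · exact measurable_pi_apply l
    · exact measurable_const
  have hx : ∀ x, MeasurableSet {y | x ∈ cfg.eliminate h A y} := by
    intro x
    simp only [Config.mem_eliminate]
    have : {y | x ∈ A ∧ ∀ z ∈ A, robustMean cfg.k cfg.lam (cfg.epochPlays h A).get y z -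
        cfg.width h A z ≤ robustMean cfg.k cfg.lam (cfg.epochPlays h A).get y x +
          cfg.width h A x} = {_y | x ∈ A} ∩ ⋂ z, ⋂ (_ : z ∈ A),
        {y | robustMean cfg.k cfg.lam (cfg.epochPlays h A).get y z - cfg.width h A z ≤
          robustMean cfg.k cfg.lam (cfg.epochPlays h A).get y x + cfg.width h A x} := by
      ext y; simp
    rw [this]
    refine (MeasurableSet.const _).inter ?_
    refine MeasurableSet.iInter fun z => MeasurableSet.iInter fun _ => ?_
    exact measurableSet_le ((hm z).sub_const _) ((hm x).add_const _)
  have : {y | cfg.eliminate h A y = A'} =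
      ⋂ x, {y | x ∈ cfg.eliminate h A y ↔ x ∈ A'} := by
    ext y
    simp [Finset.ext_iff]
  rw [this]
  refine MeasurableSet.iInter fun x => ?_
  exact (hx x).iff (MeasurableSet.const _)

variable [Fintype X] {Ω : Type*} [mΩ : MeasurableSpace Ω] {ℱ : Filtration ℕ mΩ} {e : ℕ → Ω → ℝ}

/-- The start of an epoch is a stopping time, and the active set is known by then. -/
lemma Config.measurableSet_epochStart_eq (he : ∀ t, Measurable[ℱ (t + 1)] (e t)) (f : X → ℝ) :
    ∀ (h : ℕ) (A : Finset X) (τ : ℕ),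
      MeasurableSet[ℱ τ] {ω | cfg.epochStart f (fun t => e t ω) h = (A, τ)} := by
  intro h
  induction h with
  | zero => intro A τ; exact MeasurableSet.const (((Finset.univ : Finset X), 0) = (A, τ))
  | succ h ih =>
    intro A τ
    have : {ω | cfg.epochStart f (fun t => e t ω) (h + 1) = (A, τ)} =
        ⋃ p : Finset X × ℕ, {ω | cfg.epochStart f (fun t => e t ω) h = (p.1, p.2)} ∩
          {ω | cfg.eliminate h p.1 (fun j => f ((cfg.epochPlays h p.1).get j) + e (p.2 + j) ω) = A ∧
            p.2 + (cfg.epochPlays h p.1).length = τ} := by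
      ext ω
      simp only [Set.mem_ofPred_eq, Set.mem_iUnion, Set.mem_inter_iff, Config.epochStart,
        Prod.mk.injEq]
      constructor
      · intro hω
        exact ⟨_, rfl, hω⟩
      · rintro ⟨p, hp, hω⟩
        rw [hp]
        exact hω
    rw [this]
    refine MeasurableSet.iUnion fun p => ?_
    -- Given the previous state, the epoch length is deterministic. If it ends at `τ`, all rewards
    -- used lie before round `τ`; otherwise the event is empty.
    by_cases hp : p.2 + (cfg.epochPlays h p.1).length = τ
    · refine (ℱ.mono (by omega) _ (ih p.1 p.2)).inter ?_
      simp only [hp, and_true]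
      have hm : Measurable[ℱ τ] fun ω (j : Fin (cfg.epochPlays h p.1).length) =>
          f ((cfg.epochPlays h p.1).get j) + e (p.2 + j) ω := by
        refine @measurable_pi_lambda _ _ _ (ℱ τ) _ _ fun j => ?_
        exact (measurable_le_filtration he (by omega)).const_add _
      exact hm (cfg.measurableSet_eliminate_eq h p.1 A)
    · simp only [hp, and_false, Set.ofPred_false, Set.inter_empty]
      exact @MeasurableSet.empty _ (ℱ τ)

end Adaptivity

/-! ### Simultaneous confidence bounds. -/

section Confidence

lemma deltaSeq_pos {δ : ℝ} (hδ : 0 < δ) (h : ℕ) : 0 < deltaSeq δ h := by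
  unfold deltaSeq; positivity

lemma deltaSeq_antitone {δ : ℝ} (hδ : 0 < δ) : Antitone (deltaSeq δ) := by
  intro a b hab
  unfold deltaSeq
  have : (a : ℝ) ≤ b := by exact_mod_cast hab
  gcongr

lemma hasSum_deltaSeq (δ : ℝ) : HasSum (deltaSeq δ) δ := by
  have h := (hasSum_nat_add_iff' 1).2 hasSum_zeta_two
  simp only [Finset.range_one, Finset.sum_singleton, CharP.cast_eq_zero, ne_eq, OfNat.ofNat_ne_zero,
    not_false_eq_true, zero_pow, div_zero, sub_zero] at h
  have h' := h.mul_left (6 * δ / Real.pi ^ 2)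
  have hpi := Real.pi_pos
  have e1 : deltaSeq δ = fun n : ℕ => 6 * δ / Real.pi ^ 2 * (1 / ((n + 1 : ℕ) : ℝ) ^ 2) := by
    ext n
    unfold deltaSeq
    push_cast
    field_simp
  have e2 : 6 * δ / Real.pi ^ 2 * (Real.pi ^ 2 / 6) = δ := by field_simp
  rw [e2] at h'
  rwa [e1]

lemma deltaSeq_le {δ : ℝ} (hδ : 0 < δ) (h : ℕ) : deltaSeq δ h ≤ δ := by
  have := le_hasSum (hasSum_deltaSeq δ) h fun j _ => (deltaSeq_pos hδ j).le
  exact this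

lemma betaSeq_monotone (B : ℝ) (σ : ℝ≥0) (lam : ℝ) {n : ℕ} (hn : 0 < n) {δ : ℝ} (hδ : 0 < δ) :
    Monotone (betaSeq B σ lam n δ) := by
  intro a b hab
  unfold betaSeq
  have h1 := deltaSeq_pos hδ a
  have h2 := deltaSeq_pos hδ b
  have h3 := deltaSeq_antitone hδ hab
  have hn' : (0 : ℝ) < n := by exact_mod_cast hn
  gcongr

lemma le_betaSeq (B : ℝ) (σ : ℝ≥0) (lam : ℝ) (n : ℕ) (δ : ℝ) (h : ℕ) :
    B ≤ betaSeq B σ lam n δ h := by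
  unfold betaSeq
  exact le_add_of_nonneg_right (by positivity)

variable {X H : Type*} [Fintype X] [DecidableEq X] [NormedAddCommGroup H] [InnerProductSpace ℝ H]
  {φ : X → H} {cfg : Config X}
  {Ω : Type*} [mΩ : MeasurableSpace Ω] {μ : Measure Ω} [IsProbabilityMeasure μ]
  {ℱ : Filtration ℕ mΩ} {σ : ℝ≥0} {C : ℝ} {T : ℕ} {ε c : ℕ → Ω → ℝ}

/-- One-sided confidence bounds, where the side may depend on the point. -/
lemma measure_not_confidence_le [Nonempty X] (hk : IsFeatureMap φ cfg.k) (hlam : 0 < cfg.lam)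
    {B δ : ℝ} (hδ : 0 < δ) (hδ1 : δ < 1)
    (hβ : cfg.beta = betaSeq B σ cfg.lam (Fintype.card X) δ)
    (hN : IsCorruptedNoise μ ℱ σ C T ε c) {f : X → ℝ} {g : H} (hg : ‖g‖ ≤ B)
    (hf : ∀ x, f x = inner ℝ g (φ x)) {s : X → ℝ} (hs : ∀ x, |s x| = 1) :
    μ {ω | ∀ h x, s x * (cfg.cleanMean f (fun t => ε t ω) (fun t => c t ω) T h x - f x) ≤
      cfg.beta h * cfg.epochStd f (fun t => ε t ω) (fun t => c t ω) T h x}ᶜ ≤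
      ENNReal.ofReal δ := by
  set n := Fintype.card X with hn
  have hn0 : (0 : ℝ) < n := by exact_mod_cast Fintype.card_pos
  set e : ℕ → Ω → ℝ := fun t ω => ε t ω + c t ω with he
  have hem : ∀ t, Measurable[ℱ (t + 1)] (e t) := fun t =>
    (hN.measurable_noise t).add (hN.measurable_corruption t)
  set v : ℕ → Finset X × ℕ → List X := fun h p => (cfg.epochPlays h p.1).take (T - p.2) with hv
  set E : ℕ → Finset X × ℕ → Set Ω := fun h p =>
    {ω | cfg.epochStart f (fun t => e t ω) h = p} with hE
  set L : ℕ → ℝ := fun h => Real.log (n / deltaSeq δ h) with hLdef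
  have hL : ∀ h, 0 ≤ L h := fun h => by
    refine Real.log_nonneg ?_
    rw [one_le_div (deltaSeq_pos hδ h)]
    have : (1 : ℝ) ≤ n := by exact_mod_cast Fintype.card_pos
    linarith [deltaSeq_le hδ h]
  -- On `E h p` the plays and their weights are deterministic, even in an epoch cut off by the end
  -- of the run. The bias uses up the summand `B` of `beta`, so a failure forces a large noise sum.
  set Bad : ℕ → Finset X × ℕ → X → Set Ω := fun h p x => E h p ∩
    {ω | (σ / Real.sqrt cfg.lam * postStd cfg.k cfg.lam (v h p).get x) * Real.sqrt (2 * L h) <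
      ∑ j : Fin (v h p).length,
        (s x * postWeights cfg.k cfg.lam (v h p).get x j) * ε (p.2 + j) ω} with hBad
  have hsub : {ω | ∀ h x, s x *
      (cfg.cleanMean f (fun t => ε t ω) (fun t => c t ω) T h x - f x) ≤
      cfg.beta h * cfg.epochStd f (fun t => ε t ω) (fun t => c t ω) T h x}ᶜ ⊆
      ⋃ h, ⋃ p, ⋃ x, Bad h p x := by
    intro ω hω
    simp only [Set.mem_compl_iff, Set.mem_ofPred_eq, not_forall, not_le] at hω
    obtain ⟨h, x, hx⟩ := hω
    set p := cfg.epochStart f (fun t => e t ω) h with hp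
    refine Set.mem_iUnion.2 ⟨h, Set.mem_iUnion.2 ⟨p, Set.mem_iUnion.2 ⟨x, rfl, ?_⟩⟩⟩
    have hm : cfg.cleanMean f (fun t => ε t ω) (fun t => c t ω) T h x =
        postMean cfg.k cfg.lam (v h p).get
          (fun j => f ((v h p).get j) + ε (p.2 + j) ω) x := rfl
    have hstd : cfg.epochStd f (fun t => ε t ω) (fun t => c t ω) T h x =
        postStd cfg.k cfg.lam (v h p).get x := rfl
    rw [hm, hstd, hk.postMean_eq_sum hlam, hβ] at hx
    have hbias := hk.abs_sum_postWeights_mul_sub_le hlam (v h p).get x g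
    set w := postWeights cfg.k cfg.lam (v h p).get x with hw
    set S := postStd cfg.k cfg.lam (v h p).get x with hS
    have hS0 : 0 ≤ S := Real.sqrt_nonneg _
    simp only [← hf] at hbias
    have hb : s x * (∑ j, w j * f ((v h p).get j) - f x) ≤ B * S := by
      refine (le_abs_self _).trans ?_
      rw [abs_mul, hs, one_mul]
      exact hbias.trans (mul_le_mul_of_nonneg_right hg hS0)
    have hsplit : s x * (∑ j, w j * (f ((v h p).get j) + ε (p.2 + j) ω) - f x) =
        s x * (∑ j, w j * f ((v h p).get j) - f x) + ∑ j, s x * w j * ε (p.2 + j) ω := by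
      simp only [mul_add, Finset.sum_add_distrib, mul_sub, Finset.mul_sum, mul_assoc]
      ring
    rw [hsplit, betaSeq] at hx
    simp only [Set.mem_ofPred_eq]
    nlinarith
  have hBadle : ∀ h p x, μ (Bad h p x) ≤ ENNReal.ofReal (deltaSeq δ h / n) * μ (E h p) := by
    intro h p x
    have hexp : Real.exp (-L h) = deltaSeq δ h / n := by
      rw [Real.exp_neg, Real.exp_log (div_pos hn0 (deltaSeq_pos hδ h)), inv_div]
    rw [← hexp]
    refine hN.measure_inter_lt_sum_le (cfg.measurableSet_epochStart_eq hem f h p.1 p.2) _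
      (mul_nonneg (by positivity) (Real.sqrt_nonneg _)) (hL h) ?_
    have h1 := hk.sum_sq_postWeights_le hlam (v h p).get x
    have hsq : s x ^ 2 = 1 := by rw [← sq_abs, hs]; norm_num
    simp only [mul_pow, hsq, one_mul, div_pow]
    rw [Real.sq_sqrt hlam.le, hk.sq_postStd hlam, div_mul_eq_mul_div, mul_div_assoc]
    refine mul_le_mul_of_nonneg_left ?_ (by positivity)
    rw [le_div_iff₀ hlam]
    linarith
  -- The states partition the space, so the union over them is free; only epochs and points are paid
  -- for.
  have hEsum : ∀ h, ∑' p, μ (E h p) = 1 := by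
    intro h
    rw [← measure_iUnion]
    · have : ⋃ p, E h p = Set.univ := by
        ext ω; simp [hE]
      rw [this, measure_univ]
    · intro p q hpq
      refine Set.disjoint_left.2 fun ω h1 h2 => hpq (h1.symm.trans h2)
    · intro p
      exact ℱ.le _ _ (cfg.measurableSet_epochStart_eq hem f h p.1 p.2)
  calc _ ≤ μ (⋃ h, ⋃ p, ⋃ x, Bad h p x) := measure_mono hsub
    _ ≤ ∑' h, ∑' p, ∑' x, μ (Bad h p x) := by
        refine (measure_iUnion_le _).trans (ENNReal.tsum_le_tsum fun h => ?_)
        refine (measure_iUnion_le _).trans (ENNReal.tsum_le_tsum fun p => ?_)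
        exact measure_iUnion_le _
    _ ≤ ∑' h, ∑' p, ∑' _ : X, ENNReal.ofReal (deltaSeq δ h / n) * μ (E h p) :=
        ENNReal.tsum_le_tsum fun h => ENNReal.tsum_le_tsum fun p => ENNReal.tsum_le_tsum fun x =>
          hBadle h p x
    _ = ∑' h, ENNReal.ofReal (deltaSeq δ h) := by
        refine tsum_congr fun h => ?_
        have : ∀ p, ∑' _ : X, ENNReal.ofReal (deltaSeq δ h / n) * μ (E h p) =
            ENNReal.ofReal (deltaSeq δ h) * μ (E h p) := by
          intro p
          rw [tsum_fintype, Finset.sum_const, nsmul_eq_mul, ← mul_assoc, Finset.card_univ,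
            ← ENNReal.ofReal_natCast, ← ENNReal.ofReal_mul (Nat.cast_nonneg _),
            mul_div_cancel₀ _ hn0.ne']
        simp only [this]
        rw [ENNReal.tsum_mul_left, hEsum, mul_one]
    _ = ENNReal.ofReal δ := by
        rw [← ENNReal.ofReal_tsum_of_nonneg (fun h => (deltaSeq_pos hδ h).le)
          (hasSum_deltaSeq δ).summable, (hasSum_deltaSeq δ).tsum_eq]

lemma one_sub_le_measureReal {S : Set Ω} {δ : ℝ} (hδ : 0 ≤ δ) (h : μ Sᶜ ≤ ENNReal.ofReal δ) :
    1 - δ ≤ μ.real S := by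
  have h1 : (1 : ℝ) ≤ μ.real S + μ.real Sᶜ := by
    have := measureReal_union_le (μ := μ) S Sᶜ
    rwa [Set.union_compl_self, probReal_univ] at this
  have h2 : μ.real Sᶜ ≤ δ := ENNReal.toReal_le_of_le_ofReal hδ h
  linarith

end Confidence

end RGPPE

end

noncomputable section

namespace RGPPE

/-! ### Regret of a run in which the confidence bounds hold. -/

section Regret

variable {X H : Type*} [Fintype X] [DecidableEq X] [NormedAddCommGroup H] [InnerProductSpace ℝ H]
  {φ : X → H} {cfg : Config X} {f : X → ℝ} {ε c : ℕ → ℝ} {T : ℕ}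

namespace Config

lemma epochStart_succ_snd (cfg : Config X) (f : X → ℝ) (e : ℕ → ℝ) (h : ℕ) :
    (cfg.epochStart f e (h + 1)).2 = (cfg.epochStart f e h).2 +
      (cfg.epochPlays h (cfg.epochStart f e h).1).length := rfl

lemma epochStart_succ_fst_subset (cfg : Config X) (f : X → ℝ) (e : ℕ → ℝ) (h : ℕ) :
    (cfg.epochStart f e (h + 1)).1 ⊆ (cfg.epochStart f e h).1 :=
  fun _ hx => ((cfg.mem_eliminate).1 hx).1

lemma len_le_epochStart_succ_snd (cfg : Config X) (f : X → ℝ) (e : ℕ → ℝ) (h : ℕ) :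
    len h ≤ (cfg.epochStart f e (h + 1)).2 := by
  have := cfg.len_le_length_epochPlays h (cfg.epochStart f e h).1
  rw [epochStart_succ_snd]
  omega

lemma length_playsUntil (cfg : Config X) (f : X → ℝ) (e : ℕ → ℝ) (T h : ℕ) :
    (cfg.playsUntil f e T h).length = min (T - (cfg.epochStart f e h).2)
      (cfg.epochPlays h (cfg.epochStart f e h).1).length := by
  rw [playsUntil, List.length_take]

lemma playsUntil_eq_epochPlays {cfg : Config X} {e : ℕ → ℝ} {h : ℕ}
    (hT : (cfg.epochStart f e (h + 1)).2 ≤ T) :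
    cfg.playsUntil f e T h = cfg.epochPlays h (cfg.epochStart f e h).1 := by
  rw [epochStart_succ_snd] at hT
  exact List.take_of_length_le (by omega)

lemma playsUntil_eq_nil {cfg : Config X} {e : ℕ → ℝ} {h : ℕ}
    (hT : T ≤ (cfg.epochStart f e h).2) : cfg.playsUntil f e T h = [] := by
  rw [playsUntil, Nat.sub_eq_zero_of_le hT, List.take_zero]

lemma length_actions_le (cfg : Config X) (f : X → ℝ) (e : ℕ → ℝ) (T : ℕ) :
    (cfg.actions f e T).length ≤ T := by
  have : ∀ m, ((List.range m).flatMap (cfg.playsUntil f e T)).length =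
      min T (cfg.epochStart f e m).2 := by
    intro m
    induction m with
    | zero => simp [epochStart]
    | succ m ih =>
      rw [List.range_succ, List.flatMap_append, List.length_append, ih, List.flatMap_singleton,
        length_playsUntil, epochStart_succ_snd]
      omega
  exact (this T).trans_le (min_le_left _ _)

lemma regret_eq_sum (cfg : Config X) (f : X → ℝ) (e : ℕ → ℝ) (T : ℕ) :
    cfg.regret f e T = ∑ h ∈ Finset.range T,
      ((cfg.playsUntil f e T h).map fun x => (⨆ z, f z) - f x).sum := by
  have : ∀ m, (((List.range m).flatMap (cfg.playsUntil f e T)).map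
      fun x => (⨆ z, f z) - f x).sum = ∑ h ∈ Finset.range m,
      ((cfg.playsUntil f e T h).map fun x => (⨆ z, f z) - f x).sum := by
    intro m
    induction m with
    | zero => simp
    | succ m ih =>
      rw [List.range_succ, List.flatMap_append, List.map_append, List.sum_append, ih,
        List.flatMap_singleton, Finset.sum_range_succ]
  exact this T

lemma sum_abs_block_le {C : ℝ} (hc : ∑ t ∈ Finset.range T, |c t| ≤ C) {τ u : ℕ} (hT : τ + u ≤ T) :
    ∑ j : Fin u, |c (τ + j)| ≤ C := by
  rw [← Finset.sum_range fun j => |c (τ + j)|]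
  have := Finset.sum_Ico_eq_sum_range (fun t => |c t|) τ (τ + u)
  rw [Nat.add_sub_cancel_left] at this
  rw [← this]
  refine (Finset.sum_le_sum_of_subset_of_nonneg (fun t ht => ?_) fun _ _ _ => abs_nonneg _).trans hc
  rw [Finset.mem_Ico] at ht
  exact Finset.mem_range.2 (by omega)

/-- The effect of the corruption on the posterior mean of a completed epoch. -/
lemma abs_robustMean_sub_cleanMean_le (hk : IsFeatureMap φ cfg.k) (hlam : 0 < cfg.lam)
    (hpsi : 0 < cfg.psi) (hpsi' : cfg.lam * cfg.psi ≤ 1)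
    (hc : ∑ t ∈ Finset.range T, |c t| ≤ cfg.C) {h : ℕ}
    (hT : (cfg.epochStart f (ε + c) (h + 1)).2 ≤ T) (x : X) :
    |robustMean cfg.k cfg.lam (cfg.epochPlays h (cfg.epochStart f (ε + c) h).1).get
        (fun j => f ((cfg.epochPlays h (cfg.epochStart f (ε + c) h).1).get j) +
          (ε + c) ((cfg.epochStart f (ε + c) h).2 + j)) x - cfg.cleanMean f ε c T h x| ≤
      cfg.C * Real.sqrt (cfg.epochPlays h (cfg.epochStart f (ε + c) h).1).length /
        (len h * cfg.psi * cfg.lam) *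
        postStd cfg.k cfg.lam (cfg.epochPlays h (cfg.epochStart f (ε + c) h).1).get x := by
  have hclean : cfg.cleanMean f ε c T h x = postMean cfg.k cfg.lam
      (cfg.epochPlays h (cfg.epochStart f (ε + c) h).1).get
      (fun j => f ((cfg.epochPlays h (cfg.epochStart f (ε + c) h).1).get j) +
        ε ((cfg.epochStart f (ε + c) h).2 + j)) x := by
    unfold cleanMean
    rw [playsUntil_eq_epochPlays hT]
  rw [epochStart_succ_snd] at hT
  rw [hclean, hk.robustMean_eq_postMean hlam, hk.postMean_eq_sum hlam, hk.postMean_eq_sum hlam,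
    ← Finset.sum_sub_distrib]
  set A := (cfg.epochStart f (ε + c) h).1
  set τ := (cfg.epochStart f (ε + c) h).2
  set p := cfg.epochPlays h A with hp
  have hl : (0 : ℝ) < len h := by exact_mod_cast len_pos h
  have hlp : 0 < len h * cfg.psi := mul_pos hl hpsi
  have hu : (len h : ℝ) ≤ p.length := by exact_mod_cast cfg.len_le_length_epochPlays h A
  have hC := sum_abs_block_le hc hT
  have hS : 0 ≤ postStd cfg.k cfg.lam p.get x := Real.sqrt_nonneg _
  have hC0 : 0 ≤ cfg.C := le_trans (Finset.sum_nonneg fun _ _ => abs_nonneg _) hc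
  have hw := fun j => hk.abs_postWeights_le hlam hlp (p := p)
    (fun z hz => len_mul_psi_le_count hz) x j
  calc _ ≤ ∑ j : Fin p.length, postStd cfg.k cfg.lam p.get x /
        Real.sqrt (cfg.lam * (len h * cfg.psi)) * |c (τ + j)| := by
        refine (Finset.abs_sum_le_sum_abs _ _).trans (Finset.sum_le_sum fun j _ => ?_)
        rw [← mul_sub, abs_mul, Pi.add_apply]
        have : f (p.get j) + (ε (τ + j) + c (τ + j)) - (f (p.get j) + ε (τ + j)) = c (τ + j) := by
          ring
        rw [this]
        exact mul_le_mul_of_nonneg_right (hw j) (abs_nonneg _)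
    _ ≤ postStd cfg.k cfg.lam p.get x / Real.sqrt (cfg.lam * (len h * cfg.psi)) * cfg.C := by
        rw [← Finset.mul_sum]
        exact mul_le_mul_of_nonneg_left hC (by positivity)
    _ = cfg.C * (1 / Real.sqrt (cfg.lam * (len h * cfg.psi))) *
        postStd cfg.k cfg.lam p.get x := by ring
    _ ≤ _ := by
        rw [mul_div_assoc]
        refine mul_le_mul_of_nonneg_right (mul_le_mul_of_nonneg_left ?_ hC0) hS
        -- After cancelling one factor √(λ l_h ψ), the claim is λ l_h ψ ≤ u_h. It follows from λψ ≤
        -- 1 and l_h ≤ u_h.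
        rw [div_le_div_iff₀ (by positivity) (by positivity), one_mul]
        have e : len h * cfg.psi * cfg.lam = Real.sqrt (cfg.lam * (len h * cfg.psi)) *
            Real.sqrt (cfg.lam * (len h * cfg.psi)) := by
          rw [Real.mul_self_sqrt (by positivity)]; ring
        rw [e]
        refine mul_le_mul_of_nonneg_right (Real.sqrt_le_sqrt ?_) (Real.sqrt_nonneg _)
        nlinarith

/-- Confidence bounds that hold from below at `z` and from above at all other points. -/
def ConfidentAt (cfg : Config X) (f : X → ℝ) (ε c : ℕ → ℝ) (T : ℕ) (z : X) : Prop :=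
  ∀ h x, (if x = z then -1 else 1) * (cfg.cleanMean f ε c T h x - f x) ≤
    cfg.beta h * cfg.epochStd f ε c T h x

/-- The hypotheses on the parameters and the run under which no epoch goes wrong. -/
structure GoodRun (φ : X → H) (cfg : Config X) (f : X → ℝ) (ε c : ℕ → ℝ) (T : ℕ) (z : X) :
    Prop where
  featureMap : IsFeatureMap φ cfg.k
  kernel_le_one : ∀ x, cfg.k x x ≤ 1
  lam_pos : 0 < cfg.lam
  one_lt_eta : 1 < cfg.eta
  psi_eq : cfg.psi = Real.log cfg.eta / (2 * maxInfoGain cfg.k cfg.lam T)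
  psi_pos : 0 < cfg.psi
  psi_le_one : cfg.psi ≤ 1
  lam_mul_psi_le_one : cfg.lam * cfg.psi ≤ 1
  beta_nonneg : ∀ h, 0 ≤ cfg.beta h
  budget : ∑ t ∈ Finset.range T, |c t| ≤ cfg.C
  confident : cfg.ConfidentAt f ε c T z
  maximal : ∀ x, f x ≤ f z

namespace GoodRun

variable {z : X}

lemma C_nonneg (G : GoodRun φ cfg f ε c T z) : 0 ≤ cfg.C :=
  le_trans (Finset.sum_nonneg fun _ _ => abs_nonneg _) G.budget

lemma width_nonneg (G : GoodRun φ cfg f ε c T z) (h : ℕ) (A : Finset X) (x : X) :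
    0 ≤ cfg.width h A x := by
  have := G.C_nonneg
  have := G.beta_nonneg h
  have := G.psi_pos
  have := G.lam_pos
  unfold width postStd
  positivity

/-- The two summands of `width` match the two errors: `beta` covers the clean mean, the other one
the shift by the corruption. -/
lemma robustMean_bound (G : GoodRun φ cfg f ε c T z) {h : ℕ}
    (hT : (cfg.epochStart f (ε + c) (h + 1)).2 ≤ T) (x : X) :
    (if x = z then -1 else 1) *
      (robustMean cfg.k cfg.lam (cfg.epochPlays h (cfg.epochStart f (ε + c) h).1).get
        (fun j => f ((cfg.epochPlays h (cfg.epochStart f (ε + c) h).1).get j) +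
          (ε + c) ((cfg.epochStart f (ε + c) h).2 + j)) x - f x) ≤
      cfg.width h (cfg.epochStart f (ε + c) h).1 x := by
  have h1 := abs_le.1 (abs_robustMean_sub_cleanMean_le G.featureMap G.lam_pos G.psi_pos
    G.lam_mul_psi_le_one G.budget hT x)
  have h2 := G.confident h x
  rw [epochStd, playsUntil_eq_epochPlays hT] at h2
  rw [width, add_mul]
  split_ifs at h2 ⊢ <;> linarith [h1.1, h1.2]

/-- A maximizer is never eliminated. -/
lemma mem_epochStart (G : GoodRun φ cfg f ε c T z) :
    ∀ h, (cfg.epochStart f (ε + c) h).2 ≤ T → z ∈ (cfg.epochStart f (ε + c) h).1 := by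
  intro h
  induction h with
  | zero => intro _; exact Finset.mem_univ z
  | succ h ih =>
    intro hT
    have hz : z ∈ (cfg.epochStart f (ε + c) h).1 := ih (by rw [epochStart_succ_snd] at hT; omega)
    refine cfg.mem_eliminate.2 ⟨hz, fun x hx => ?_⟩
    by_cases hxz : x = z
    · rw [hxz]
      linarith [G.width_nonneg h (cfg.epochStart f (ε + c) h).1 z]
    · have h1 := G.robustMean_bound hT x
      have h2 := G.robustMean_bound hT z
      rw [if_neg hxz] at h1
      rw [if_pos rfl] at h2
      linarith [G.maximal x]

/-- The regret of a point that is active after an epoch. -/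
lemma sub_le_width (G : GoodRun φ cfg f ε c T z) {h : ℕ}
    (hT : (cfg.epochStart f (ε + c) (h + 1)).2 ≤ T) {x : X}
    (hx : x ∈ (cfg.epochStart f (ε + c) (h + 1)).1) :
    f z - f x ≤ 2 * cfg.width h (cfg.epochStart f (ε + c) h).1 z +
      2 * cfg.width h (cfg.epochStart f (ε + c) h).1 x := by
  have hz : z ∈ (cfg.epochStart f (ε + c) h).1 :=
    cfg.epochStart_succ_fst_subset _ _ _ (G.mem_epochStart _ hT)
  by_cases hxz : x = z
  · rw [hxz]
    linarith [G.width_nonneg h (cfg.epochStart f (ε + c) h).1 z]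
  · have h1 := G.robustMean_bound hT x
    have h2 := G.robustMean_bound hT z
    have h3 := (cfg.mem_eliminate.1 hx).2 z hz
    rw [if_neg hxz] at h1
    rw [if_pos rfl] at h2
    linarith

lemma two_mul_maxInfoGain_pos (G : GoodRun φ cfg f ε c T z) :
    0 < 2 * maxInfoGain cfg.k cfg.lam T := by
  by_contra hn
  have h1 := G.psi_pos
  rw [G.psi_eq] at h1
  exact absurd h1 (not_lt.2 (div_nonpos_of_nonneg_of_nonpos (Real.log_pos G.one_lt_eta).le
    (not_lt.1 hn)))

/-- The potential bound gives standard deviation at most D√(γ/l_h). With u_h ≤ 4 l_h and 1/ψ =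
2γ/log η, the corruption term becomes C γ^(3/2)/l_h up to constants. -/
lemma width_le (G : GoodRun φ cfg f ε c T z) {h : ℕ} (hT : len h ≤ T) {A : Finset X} {x : X}
    (hx : x ∈ A) {D γ : ℝ} (hD : D = Real.sqrt (2 * cfg.eta / Real.log (1 + cfg.lam⁻¹)))
    (hγ : γ = maxInfoGain cfg.k cfg.lam T) :
    cfg.width h A x ≤ cfg.beta h * (D * Real.sqrt γ / Real.sqrt (len h)) +
      4 * D / (cfg.lam * Real.log cfg.eta) * (cfg.C * γ ^ (3 / 2 : ℝ)) / len h := by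
  have hl : (0 : ℝ) < len h := by exact_mod_cast len_pos h
  have hlam := G.lam_pos
  have hL : 0 < Real.log (1 + cfg.lam⁻¹) :=
    Real.log_pos (by have := inv_pos.2 hlam; linarith)
  have hη := Real.log_pos G.one_lt_eta
  have hη0 : 0 < cfg.eta := by linarith [G.one_lt_eta]
  have hγ0 : 0 < γ := by have := G.two_mul_maxInfoGain_pos; rw [← hγ] at this; linarith
  have hC := G.C_nonneg
  have hβ := G.beta_nonneg h
  have hpsi := G.psi_pos
  have hD0 : 0 ≤ D := by rw [hD]; positivity
  have hu : ((cfg.epochPlays h A).length : ℝ) ≤ 4 * len h := by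
    exact_mod_cast length_epochPlays_le G.featureMap G.kernel_le_one hlam G.one_lt_eta G.psi_eq
      hpsi G.psi_le_one hT A
  have hsu : Real.sqrt (cfg.epochPlays h A).length ≤ 2 * Real.sqrt (len h) := by
    refine (Real.sqrt_le_sqrt hu).trans_eq ?_
    rw [Real.sqrt_mul (by norm_num), show (4 : ℝ) = 2 ^ 2 by norm_num,
      Real.sqrt_sq (by norm_num)]
  have hstd : postStd cfg.k cfg.lam (cfg.epochPlays h A).get x ≤
      D * Real.sqrt γ / Real.sqrt (len h) := by
    rw [hD, ← Real.sqrt_mul (by positivity), ← Real.sqrt_div (by positivity)]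
    refine Real.sqrt_le_sqrt ?_
    have := len_mul_postVar_epochPlays_le G.featureMap G.kernel_le_one hlam G.one_lt_eta.le hT hx
    rw [← hγ] at this
    rw [div_mul_eq_mul_div, div_div, le_div_iff₀ (by positivity)]
    linarith
  have hγ32 : γ ^ (3 / 2 : ℝ) = γ * Real.sqrt γ := by
    rw [Real.sqrt_eq_rpow, ← Real.rpow_one_add' hγ0.le (by norm_num)]
    norm_num
  have hs : 0 < Real.sqrt (len h) := Real.sqrt_pos.2 hl
  have hsl : Real.sqrt (len h) * Real.sqrt (len h) = len h := Real.mul_self_sqrt hl.le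
  calc cfg.width h A x ≤ (cfg.beta h + cfg.C * (2 * Real.sqrt (len h)) /
        (len h * cfg.psi * cfg.lam)) * (D * Real.sqrt γ / Real.sqrt (len h)) := by
        unfold width
        have : 0 ≤ postStd cfg.k cfg.lam (cfg.epochPlays h A).get x := Real.sqrt_nonneg _
        gcongr
    _ = _ := by
        rw [add_mul, hγ32, G.psi_eq, ← hγ]
        congr 1
        field_simp
        ring

/-- The regret of an epoch that follows a completed one. -/
lemma epoch_regret_le (G : GoodRun φ cfg f ε c T z) {h : ℕ}
    (hT : (cfg.epochStart f (ε + c) (h + 1)).2 < T) {D γ : ℝ}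
    (hD : D = Real.sqrt (2 * cfg.eta / Real.log (1 + cfg.lam⁻¹)))
    (hγ : γ = maxInfoGain cfg.k cfg.lam T) :
    ((cfg.playsUntil f (ε + c) T (h + 1)).map fun x => f z - f x).sum ≤
      12 * D * cfg.beta h * Real.sqrt (T * γ) +
        128 * D / (cfg.lam * Real.log cfg.eta) * (cfg.C * γ ^ (3 / 2 : ℝ)) := by
  have hlen : len h ≤ T := (cfg.len_le_epochStart_succ_snd f (ε + c) h).trans hT.le
  have hl : (0 : ℝ) < len h := by exact_mod_cast len_pos h
  have hlT : (len h : ℝ) ≤ T := by exact_mod_cast hlen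
  have hz := G.mem_epochStart _ hT.le
  set W := cfg.beta h * (D * Real.sqrt γ / Real.sqrt (len h)) +
      4 * D / (cfg.lam * Real.log cfg.eta) * (cfg.C * γ ^ (3 / 2 : ℝ)) / len h with hW
  set n := (cfg.playsUntil f (ε + c) T (h + 1)).length with hn
  have hreg : ∀ x ∈ cfg.playsUntil f (ε + c) T (h + 1), f z - f x ≤ 4 * W := by
    intro x hx
    have hx' : x ∈ (cfg.epochStart f (ε + c) (h + 1)).1 :=
      cfg.mem_of_mem_loopPoints ⟨z, hz⟩ (mem_epochPlays (List.mem_of_mem_take hx))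
    have h1 := G.sub_le_width hT.le hx'
    have h2 := G.width_le hlen (cfg.epochStart_succ_fst_subset _ _ _ hz) hD hγ
    have h3 := G.width_le hlen (cfg.epochStart_succ_fst_subset _ _ _ hx') hD hγ
    linarith
  have hsum : ((cfg.playsUntil f (ε + c) T (h + 1)).map fun x => f z - f x).sum ≤ n * (4 * W) := by
    have := List.sum_le_card_nsmul ((cfg.playsUntil f (ε + c) T (h + 1)).map fun x => f z - f x)
      (4 * W) (by simpa using hreg)
    rwa [List.length_map, nsmul_eq_mul] at this
  have hnT : n ≤ T := by rw [hn, length_playsUntil]; omega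
  -- If the next nominal length exceeds `T`, its length bound is unavailable, but then the run
  -- itself has fewer than 2 l_h rounds.
  have hn8 : n ≤ 8 * len h := by
    have e : len (h + 1) = 2 * len h := by unfold len; ring
    rcases le_or_gt (len (h + 1)) T with h1 | h1
    · have := length_epochPlays_le G.featureMap G.kernel_le_one G.lam_pos G.one_lt_eta G.psi_eq
        G.psi_pos G.psi_le_one h1 (cfg.epochStart f (ε + c) (h + 1)).1
      rw [hn, length_playsUntil]
      omega
    · omega
  have hnT' : (n : ℝ) ≤ T := by exact_mod_cast hnT
  have hn8' : (n : ℝ) ≤ 8 * len h := by exact_mod_cast hn8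
  have hs : 0 < Real.sqrt (len h) := Real.sqrt_pos.2 hl
  -- From n ≤ T and n ≤ 8 l_h follows n² ≤ 8 T l_h ≤ 9 T l_h.
  have hnsqrt : (n : ℝ) ≤ 3 * Real.sqrt T * Real.sqrt (len h) := by
    rw [mul_assoc, ← Real.sqrt_mul (Nat.cast_nonneg _)]
    refine le_of_sq_le_sq ?_ (by positivity)
    rw [mul_pow, Real.sq_sqrt (by positivity)]
    nlinarith [Nat.cast_nonneg (α := ℝ) n, mul_nonneg (Nat.cast_nonneg (α := ℝ) T) hl.le]
  have hη := Real.log_pos G.one_lt_eta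
  have hγ0 : 0 < γ := by have := G.two_mul_maxInfoGain_pos; rw [← hγ] at this; linarith
  have hD0 : 0 ≤ D := by rw [hD]; positivity
  have hC := G.C_nonneg
  have hβ := G.beta_nonneg h
  have hlam := G.lam_pos
  refine hsum.trans ?_
  have p1 : 0 ≤ cfg.beta h * D * Real.sqrt γ / Real.sqrt (len h) := by positivity
  have p2 : 0 ≤ D / (cfg.lam * Real.log cfg.eta) * (cfg.C * γ ^ (3 / 2 : ℝ)) / len h := by
    positivity
  calc (n : ℝ) * (4 * W) = 4 * (n * (cfg.beta h * D * Real.sqrt γ / Real.sqrt (len h))) +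
        16 * (n * (D / (cfg.lam * Real.log cfg.eta) * (cfg.C * γ ^ (3 / 2 : ℝ)) / len h)) := by
        rw [hW]; ring
    _ ≤ 4 * ((3 * Real.sqrt T * Real.sqrt (len h)) *
          (cfg.beta h * D * Real.sqrt γ / Real.sqrt (len h))) +
        16 * ((8 * len h) *
          (D / (cfg.lam * Real.log cfg.eta) * (cfg.C * γ ^ (3 / 2 : ℝ)) / len h)) := by
        gcongr
    _ = _ := by
        rw [Real.sqrt_mul (Nat.cast_nonneg _)]
        field_simp
        ring

end GoodRun

end Config

lemma nat_log_le_two_mul_log (T : ℕ) (hT : 1 ≤ T) : (Nat.log 2 T : ℝ) ≤ 2 * Real.log T := by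
  have h1 : ((2 ^ Nat.log 2 T : ℕ) : ℝ) ≤ T := by
    exact_mod_cast Nat.pow_log_le_self 2 (by omega)
  have h2 := Real.log_le_log (by positivity) h1
  rw [Nat.cast_pow, Real.log_pow] at h2
  have h3 := Real.log_two_gt_d9
  push_cast at h2
  have : (0 : ℝ) ≤ Nat.log 2 T := Nat.cast_nonneg _
  nlinarith

/-- Since 2^(h+1) ≤ T, the index `h` is O(log T), so splitting δ over the epochs costs only an
additive log(1 + log T) inside the root. -/
lemma betaSeq_le {B lam δ : ℝ} (hB : 0 ≤ B) (σ : ℝ≥0) {n : ℕ} (hn : 0 < n) (hδ : 0 < δ)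
    (hδ1 : δ < 1) {h T : ℕ} (hT : Config.len h ≤ T) :
    betaSeq B σ lam n δ h ≤ (B + 3 * (σ / Real.sqrt lam)) *
      Real.sqrt (1 + Real.log (n / δ) + Real.log (1 + Real.log T)) := by
  have hn1 : (1 : ℝ) ≤ n := by exact_mod_cast hn
  have hT1 : 1 ≤ T := (Config.len_pos h).trans_le hT
  have hlogT : 0 ≤ Real.log T := Real.log_natCast_nonneg T
  have hnδ : 0 ≤ Real.log (n / δ) := Real.log_nonneg (by rw [one_le_div hδ]; linarith)
  have hll : 0 ≤ Real.log (1 + Real.log T) := Real.log_nonneg (by linarith)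
  set Q := 1 + Real.log (n / δ) + Real.log (1 + Real.log T) with hQ
  have hQ1 : 1 ≤ Real.sqrt Q := Real.one_le_sqrt.2 (by linarith)
  have hh : (h : ℝ) + 1 ≤ 2 * (1 + Real.log T) := by
    have h1 : h + 1 ≤ Nat.log 2 T := Nat.le_log_of_pow_le (by norm_num) hT
    have h2 : ((h + 1 : ℕ) : ℝ) ≤ Nat.log 2 T := by exact_mod_cast h1
    have := nat_log_le_two_mul_log T hT1
    push_cast at h2
    linarith
  have hlog : Real.log (n / deltaSeq δ h) ≤ 4 * Q := by
    have e : n / deltaSeq δ h = n / δ * (((h : ℝ) + 1) ^ 2 * (Real.pi ^ 2 / 6)) := by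
      unfold deltaSeq
      field_simp
    have hpi : Real.pi ^ 2 / 6 ≤ 2 := by nlinarith [Real.pi_lt_d2, Real.pi_pos]
    have hpi0 := Real.pi_pos
    have h1 : Real.log (((h : ℝ) + 1) ^ 2 * (Real.pi ^ 2 / 6)) ≤
        Real.log ((2 * (1 + Real.log T)) ^ 2 * 2) := by
      refine Real.log_le_log (by positivity) ?_
      gcongr
    have h2 : Real.log ((2 * (1 + Real.log T)) ^ 2 * 2) =
        2 * Real.log (1 + Real.log T) + 3 * Real.log 2 := by
      rw [Real.log_mul (by positivity) (by norm_num), Real.log_pow,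
        Real.log_mul (by norm_num) (by positivity)]
      push_cast
      ring
    rw [e, Real.log_mul (by positivity) (by positivity)]
    linarith [Real.log_two_lt_d9]
  have hsq : Real.sqrt (2 * Real.log (n / deltaSeq δ h)) ≤ 3 * Real.sqrt Q := by
    have : (3 : ℝ) = Real.sqrt 9 := by
      rw [show (9 : ℝ) = 3 ^ 2 by norm_num, Real.sqrt_sq (by norm_num)]
    rw [this, ← Real.sqrt_mul (by norm_num)]
    exact Real.sqrt_le_sqrt (by linarith)
  unfold betaSeq
  have h1 : 0 ≤ (σ : ℝ) / Real.sqrt lam := by positivity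
  nlinarith [mul_le_mul_of_nonneg_left hsq h1, mul_le_mul_of_nonneg_left hQ1 hB]

namespace Config

/-- The regret of a run in which the confidence bounds hold. -/
lemma GoodRun.regret_le {z : X} (G : GoodRun φ cfg f ε c T z) {B δ γ D Q : ℝ} {σ : ℝ≥0}
    (hT : 1 ≤ T) (hB : 0 ≤ B) (hf : ∀ x, |f x| ≤ B) (hδ : 0 < δ) (hδ1 : δ < 1)
    (hβ : cfg.beta = betaSeq B σ cfg.lam (Fintype.card X) δ)
    (hD : D = Real.sqrt (2 * cfg.eta / Real.log (1 + cfg.lam⁻¹)))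
    (hγ : γ = maxInfoGain cfg.k cfg.lam T)
    (hQ : Q = Real.sqrt (1 + Real.log (Fintype.card X / δ) + Real.log (1 + Real.log T))) :
    cfg.regret f (ε + c) T ≤ 2 * (8 * B * Real.sqrt (2 / Real.log cfg.eta) +
      12 * D * (B + 3 * (σ / Real.sqrt cfg.lam)) + 128 * D / (cfg.lam * Real.log cfg.eta)) *
      (1 + Real.log T) * (Q * Real.sqrt (T * γ) + cfg.C * γ ^ (3 / 2 : ℝ)) := by
  have : Nonempty X := ⟨z⟩
  have hsup : (⨆ x, f x) = f z :=
    le_antisymm (ciSup_le G.maximal) (le_ciSup (Set.finite_range f).bddAbove z)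
  have hcard : 0 < Fintype.card X := Fintype.card_pos_iff.2 ⟨z⟩
  have hη := Real.log_pos G.one_lt_eta
  have hlam := G.lam_pos
  have hC := G.C_nonneg
  have hγ0 : 0 < γ := by have := G.two_mul_maxInfoGain_pos; rw [← hγ] at this; linarith
  have hD0 : 0 ≤ D := by rw [hD]; positivity
  have hlogT : 0 ≤ Real.log T := Real.log_natCast_nonneg T
  have hQ1 : 1 ≤ Q := by
    have hn1 : (1 : ℝ) ≤ Fintype.card X := by exact_mod_cast hcard
    have hnδ : 0 ≤ Real.log (Fintype.card X / δ) :=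
      Real.log_nonneg (by rw [one_le_div hδ]; linarith)
    have hll : 0 ≤ Real.log (1 + Real.log T) := Real.log_nonneg (by linarith)
    rw [hQ]
    exact Real.one_le_sqrt.2 (by linarith)
  set P := Q * Real.sqrt (T * γ) with hP
  set R := cfg.C * γ ^ (3 / 2 : ℝ) with hR
  set a := 8 * B * Real.sqrt (2 / Real.log cfg.eta) with ha
  set b := 12 * D * (B + 3 * (σ / Real.sqrt cfg.lam)) with hb
  set d := 128 * D / (cfg.lam * Real.log cfg.eta) with hd
  have hP0 : 0 ≤ P := by positivity
  have hR0 : 0 ≤ R := by positivity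
  have ha0 : 0 ≤ a := by positivity
  have hb0 : 0 ≤ b := by positivity
  have hd0 : 0 ≤ d := by positivity
  have hepoch : ∀ h, ((cfg.playsUntil f (ε + c) T h).map fun x => f z - f x).sum ≤
      if h ≤ Nat.log 2 T then (a + b + d) * (P + R) else 0 := by
    intro h
    rcases le_or_gt T (cfg.epochStart f (ε + c) h).2 with h1 | h1
    · rw [playsUntil_eq_nil h1]
      split_ifs
      · simp only [List.map_nil, List.sum_nil]; positivity
      · simp
    · rcases h with _ | h
      · rw [if_pos (Nat.zero_le _)]
        have hreg : ∀ x ∈ cfg.playsUntil f (ε + c) T 0, f z - f x ≤ 2 * B := fun x _ => by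
          linarith [abs_le.1 (hf z), abs_le.1 (hf x)]
        have := List.sum_le_card_nsmul ((cfg.playsUntil f (ε + c) T 0).map fun x => f z - f x)
          (2 * B) (by simpa using hreg)
        rw [List.length_map, nsmul_eq_mul] at this
        have hlen : (cfg.playsUntil f (ε + c) T 0).length ≤ 4 := by
          have := length_epochPlays_le_sq G.psi_le_one 0 (cfg.epochStart f (ε + c) 0).1
          rw [length_playsUntil]
          exact (min_le_right _ _).trans this
        have hlen' : ((cfg.playsUntil f (ε + c) T 0).length : ℝ) ≤ 4 := by exact_mod_cast hlen
        -- ψ ≤ 1 means log η ≤ 2γ. This lets the regret of the initial epoch, at most four plays at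
        -- 2B each, be absorbed into √(Tγ).
        have hTγ : 1 ≤ Real.sqrt (2 / Real.log cfg.eta) * Real.sqrt (T * γ) := by
          rw [← Real.sqrt_mul (by positivity), Real.one_le_sqrt, div_mul_eq_mul_div,
            one_le_div hη]
          have h2 := G.psi_le_one
          rw [G.psi_eq, ← hγ, div_le_one (by positivity)] at h2
          have : (1 : ℝ) ≤ T := by exact_mod_cast hT
          nlinarith
        have h8 : 8 * B ≤ a * P := by
          have q1 : 1 * 1 ≤ Q * (Real.sqrt (2 / Real.log cfg.eta) * Real.sqrt (T * γ)) :=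
            mul_le_mul hQ1 hTγ zero_le_one (by linarith)
          calc 8 * B = 8 * B * (1 * 1) := by ring
            _ ≤ 8 * B * (Q * (Real.sqrt (2 / Real.log cfg.eta) * Real.sqrt (T * γ))) :=
                mul_le_mul_of_nonneg_left q1 (by positivity)
            _ = a * P := by rw [ha, hP]; ring
        have : ((cfg.playsUntil f (ε + c) T 0).length : ℝ) * (2 * B) ≤ 4 * (2 * B) :=
          mul_le_mul_of_nonneg_right hlen' (by positivity)
        have : 0 ≤ a * R + b * (P + R) + d * (P + R) := by positivity
        linarith
      · have hlen : len h ≤ T := (cfg.len_le_epochStart_succ_snd f (ε + c) h).trans h1.le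
        -- An epoch that starts before round `T` comes after one of nominal length 2^(h+1) ≤ T; this
        -- bounds the number of nonempty epochs.
        rw [if_pos (Nat.le_log_of_pow_le (by norm_num) hlen)]
        refine (G.epoch_regret_le h1 hD hγ).trans ?_
        have hβle := betaSeq_le (lam := cfg.lam) hB σ hcard hδ hδ1 hlen
        rw [← hβ, ← hQ] at hβle
        have : 12 * D * cfg.beta h * Real.sqrt (T * γ) ≤ b * P := by
          calc 12 * D * cfg.beta h * Real.sqrt (T * γ)
              ≤ 12 * D * ((B + 3 * (σ / Real.sqrt cfg.lam)) * Q) * Real.sqrt (T * γ) := by gcongr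
            _ = b * P := by rw [hb, hP]; ring
        have : 0 ≤ a * (P + R) + b * R + d * P := by positivity
        linarith
  rw [regret_eq_sum, hsup]
  calc _ ≤ ∑ h ∈ Finset.range T, if h ≤ Nat.log 2 T then (a + b + d) * (P + R) else 0 :=
        Finset.sum_le_sum fun h _ => hepoch h
    _ ≤ ((Nat.log 2 T + 1 : ℕ) : ℝ) * ((a + b + d) * (P + R)) := by
        rw [← Finset.sum_filter, Finset.sum_const, nsmul_eq_mul]
        refine mul_le_mul_of_nonneg_right ?_ (by positivity)
        have : ((Finset.range T).filter fun h => h ≤ Nat.log 2 T) ⊆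
            Finset.range (Nat.log 2 T + 1) := fun h hh =>
          Finset.mem_range.2 (Nat.lt_succ_of_le (Finset.mem_filter.1 hh).2)
        exact_mod_cast (Finset.card_le_card this).trans_eq (Finset.card_range _)
    _ ≤ 2 * (1 + Real.log T) * ((a + b + d) * (P + R)) := by
        refine mul_le_mul_of_nonneg_right ?_ (by positivity)
        have := nat_log_le_two_mul_log T hT
        push_cast
        linarith
    _ = _ := by ring

/-- The regret when the information gain is small. -/
lemma regret_le_of_maxInfoGain_le [Nonempty X] (hk : IsFeatureMap φ cfg.k) (hlam : 0 < cfg.lam)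
    (hT : 1 ≤ T) {B M γ : ℝ} (e : ℕ → ℝ) {g : H} (hg : ‖g‖ ≤ B)
    (hf : ∀ x, f x = inner ℝ g (φ x)) (hγ : γ = maxInfoGain cfg.k cfg.lam T) (hM : 2 * γ ≤ M) :
    cfg.regret f e T ≤ 2 * B * Real.sqrt (2 * cfg.lam * Real.exp M) * Real.sqrt (T * γ) := by
  have hT0 : (0 : ℝ) < T := by exact_mod_cast hT
  have hB : 0 ≤ B := (norm_nonneg g).trans hg
  have hkx : ∀ x, T * cfg.k x x ≤ 2 * cfg.lam * Real.exp M * γ ∧ 0 ≤ γ := by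
    intro x
    have h0 := hk.self_nonneg x
    have h1 := IsFeatureMap.log_one_add_mul_le_maxInfoGain cfg.k cfg.lam T x
    rw [← hγ] at h1
    have hpos : 0 ≤ T * cfg.k x x / cfg.lam := by positivity
    have hγ0 : 0 ≤ γ := by linarith [Real.log_nonneg (by linarith : 1 ≤ 1 + T * cfg.k x x / cfg.lam)]
    refine ⟨?_, hγ0⟩
    have h2 : 1 + T * cfg.k x x / cfg.lam ≤ Real.exp (2 * γ) :=
      (Real.log_le_iff_le_exp (by positivity)).1 h1
    have h3 : Real.exp (2 * γ) - 1 ≤ 2 * γ * Real.exp (2 * γ) := by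
      have := mul_le_mul_of_nonneg_left (Real.one_sub_le_exp_neg (2 * γ)) (Real.exp_pos (2 * γ)).le
      rw [← Real.exp_add, add_neg_cancel, Real.exp_zero] at this
      linarith
    have h4 : Real.exp (2 * γ) ≤ Real.exp M := Real.exp_le_exp.2 hM
    have h5 : T * cfg.k x x / cfg.lam ≤ 2 * γ * Real.exp M := by
      nlinarith [mul_le_mul_of_nonneg_left h4 hγ0]
    rw [div_le_iff₀ hlam] at h5
    linarith
  have hγ0 : 0 ≤ γ := (hkx (Classical.arbitrary X)).2
  -- Here k(x,x) = O(γ/T), so |f| ≤ B √k(x,x) is of order √(γ/T), and `T` rounds cost at most order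
  -- √(Tγ).
  set b := B * Real.sqrt (2 * cfg.lam * Real.exp M * γ / T) with hb
  have hfx : ∀ x, |f x| ≤ b := by
    intro x
    rw [hf]
    refine (abs_real_inner_le_norm _ _).trans ?_
    refine mul_le_mul hg (Real.le_sqrt_of_sq_le ?_) (norm_nonneg _) hB
    rw [← hk.self_eq_norm_sq, le_div_iff₀ hT0, mul_comm]
    exact (hkx x).1
  have hsup : (⨆ x, f x) ≤ b := ciSup_le fun x => (abs_le.1 (hfx x)).2
  have hsum := List.sum_le_card_nsmul ((cfg.actions f e T).map fun x => (⨆ z, f z) - f x) (2 * b)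
    (by
      intro y hy
      obtain ⟨x, _, rfl⟩ := List.mem_map.1 hy
      linarith [(abs_le.1 (hfx x)).1])
  rw [List.length_map, nsmul_eq_mul] at hsum
  have hb0 : 0 ≤ b := by positivity
  have hlen : ((cfg.actions f e T).length : ℝ) ≤ T := by
    exact_mod_cast cfg.length_actions_le f e T
  refine hsum.trans ((mul_le_mul_of_nonneg_right hlen (by positivity)).trans_eq ?_)
  have e1 : (T : ℝ) * Real.sqrt (2 * cfg.lam * Real.exp M * γ / T) =
      Real.sqrt (2 * cfg.lam * Real.exp M) * Real.sqrt (T * γ) := by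
    rw [← Real.sqrt_mul (by positivity)]
    have : (2 * cfg.lam * Real.exp M * (T * γ)) = T ^ 2 * (2 * cfg.lam * Real.exp M * γ / T) := by
      field_simp
    rw [this, Real.sqrt_mul (by positivity), Real.sqrt_sq hT0.le]
  rw [hb, mul_left_comm, mul_left_comm (T : ℝ), e1]
  ring

end Config

end Regret

end RGPPE

end

/-! ### Both regimes of the information gain, and the final assembly. -/

noncomputable section

namespace RGPPE

lemma isFeatureMap_kerFun {X : Type*} (H : Type*) [NormedAddCommGroup H] [InnerProductSpace ℝ H]
    [CompleteSpace H] [RKHS ℝ H X ℝ] :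
    IsFeatureMap (fun x => RKHS.kerFun H x (1 : ℝ)) (rkernel H : X → X → ℝ) := by
  intro x y
  have := RKHS.kernel_inner H x y (1 : ℝ) 1
  rw [real_inner_comm (RKHS.kerFun H y 1), ← this]
  simp [rkernel]

open MeasureTheory ProbabilityTheory

variable {X Ω : Type*} [Fintype X] [DecidableEq X] [Nonempty X]
  {H : Type*} [NormedAddCommGroup H] [InnerProductSpace ℝ H] {φ : X → H} {cfg : Config X}
  [mΩ : MeasurableSpace Ω] {μ : Measure Ω} [IsProbabilityMeasure μ]
  {ℱ : Filtration ℕ mΩ} {σ : ℝ≥0} {T : ℕ} {ε c : ℕ → Ω → ℝ}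

/-- The constant of the regret bound. -/
def regretConst (B lam η σ : ℝ) : ℝ :=
  2 * B * Real.sqrt (2 * lam * Real.exp (max 1 lam * Real.log η)) +
    2 * (8 * B * Real.sqrt (2 / Real.log η) +
      12 * Real.sqrt (2 * η / Real.log (1 + lam⁻¹)) * (B + 3 * (σ / Real.sqrt lam)) +
      128 * Real.sqrt (2 * η / Real.log (1 + lam⁻¹)) / (lam * Real.log η))

/-- The regret bound, with the probability of a single one-sided confidence bound per point. -/
lemma measure_not_regret_le (hk : IsFeatureMap φ cfg.k) (hk1 : ∀ x, cfg.k x x ≤ 1)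
    (hlam : 0 < cfg.lam) (heta : 1 < cfg.eta)
    (hpsi : cfg.psi = Real.log cfg.eta / (2 * maxInfoGain cfg.k cfg.lam T))
    {B δ : ℝ} (hδ : 0 < δ) (hδ1 : δ < 1) (hT : 1 ≤ T) (hC : 0 ≤ cfg.C)
    (hβ : cfg.beta = betaSeq B σ cfg.lam (Fintype.card X) δ)
    (hN : IsCorruptedNoise μ ℱ σ cfg.C T ε c) {f : X → ℝ} {g : H} (hg : ‖g‖ ≤ B)
    (hf : ∀ x, f x = inner ℝ g (φ x)) :
    μ {ω | cfg.regret f (fun t => ε t ω + c t ω) T ≤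
      regretConst B cfg.lam cfg.eta σ * (1 + Real.log T) *
        (Real.sqrt (1 + Real.log (Fintype.card X / δ) + Real.log (1 + Real.log T)) *
          Real.sqrt (T * maxInfoGain cfg.k cfg.lam T) +
            cfg.C * maxInfoGain cfg.k cfg.lam T ^ (3 / 2 : ℝ))}ᶜ ≤ ENNReal.ofReal δ := by
  set γ := maxInfoGain cfg.k cfg.lam T with hγ
  set Q := Real.sqrt (1 + Real.log (Fintype.card X / δ) + Real.log (1 + Real.log T)) with hQ
  set K₁ := 2 * B * Real.sqrt (2 * cfg.lam * Real.exp (max 1 cfg.lam * Real.log cfg.eta)) with hK₁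
  set D := Real.sqrt (2 * cfg.eta / Real.log (1 + cfg.lam⁻¹)) with hD
  set K₂ := 2 * (8 * B * Real.sqrt (2 / Real.log cfg.eta) +
      12 * D * (B + 3 * (σ / Real.sqrt cfg.lam)) + 128 * D / (cfg.lam * Real.log cfg.eta)) with hK₂
  have hconst : regretConst B cfg.lam cfg.eta σ = K₁ + K₂ := rfl
  have hB : 0 ≤ B := (norm_nonneg g).trans hg
  have hη := Real.log_pos heta
  have hlogT : 0 ≤ Real.log T := Real.log_natCast_nonneg T
  have hK₁0 : 0 ≤ K₁ := by positivity
  have hK₂0 : 0 ≤ K₂ := by positivity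
  have hγ0 : 0 ≤ γ := by
    have h1 := IsFeatureMap.log_one_add_mul_le_maxInfoGain cfg.k cfg.lam T (Classical.arbitrary X)
    have h0 := hk.self_nonneg (Classical.arbitrary X)
    have hpos : 0 ≤ T * cfg.k (Classical.arbitrary X) (Classical.arbitrary X) / cfg.lam := by
      positivity
    have := Real.log_nonneg (le_add_of_nonneg_right hpos)
    linarith
  have hQ1 : 1 ≤ Q := by
    have hn1 : (1 : ℝ) ≤ Fintype.card X := by exact_mod_cast Fintype.card_pos
    have hnδ : 0 ≤ Real.log (Fintype.card X / δ) :=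
      Real.log_nonneg (by rw [one_le_div hδ]; linarith)
    have hll : 0 ≤ Real.log (1 + Real.log T) := Real.log_nonneg (by linarith)
    exact Real.one_le_sqrt.2 (by linarith)
  set P := Real.sqrt (T * γ) with hP
  have hP0 : 0 ≤ P := Real.sqrt_nonneg _
  set R := cfg.C * γ ^ (3 / 2 : ℝ) with hR
  have hR0 : 0 ≤ R := by positivity
  have hQP : 0 ≤ Q * P + R := by positivity
  have hsmall : ∀ {r : ℝ}, r ≤ K₁ * P → r ≤ (K₁ + K₂) * (1 + Real.log T) * (Q * P + R) := by
    intro r hr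
    refine hr.trans ?_
    calc K₁ * P ≤ (K₁ + K₂) * 1 * (Q * P + R) := by
          rw [mul_one]
          refine mul_le_mul (by linarith) ?_ hP0 (by linarith)
          nlinarith [mul_le_mul_of_nonneg_right hQ1 hP0]
      _ ≤ _ := by gcongr; linarith
  have hlarge : ∀ {r : ℝ}, r ≤ K₂ * (1 + Real.log T) * (Q * P + R) →
      r ≤ (K₁ + K₂) * (1 + Real.log T) * (Q * P + R) := by
    intro r hr
    refine hr.trans ?_
    gcongr
    linarith
  rw [hconst]
  -- The threshold is chosen so that above it both ψ ≤ 1 and λψ ≤ 1 hold. Below it the bound holds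
  -- surely.
  rcases le_or_gt (2 * γ) (max 1 cfg.lam * Real.log cfg.eta) with hM | hM
  · have : {ω | cfg.regret f (fun t => ε t ω + c t ω) T ≤
        (K₁ + K₂) * (1 + Real.log T) * (Q * P + R)} = Set.univ :=
      Set.eq_univ_of_forall fun ω =>
        hsmall (Config.regret_le_of_maxInfoGain_le hk hlam hT _ hg hf hγ hM)
    rw [this, Set.compl_univ, measure_empty]
    exact zero_le
  · have hγ2 : 0 < 2 * γ := lt_of_le_of_lt (by positivity) hM
    have hpsi0 : 0 < cfg.psi := by rw [hpsi]; positivity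
    have hpsi1 : cfg.psi ≤ 1 := by
      rw [hpsi, div_le_one hγ2]
      nlinarith [le_max_left 1 cfg.lam]
    have hpsi2 : cfg.lam * cfg.psi ≤ 1 := by
      rw [hpsi, mul_div_assoc', div_le_one hγ2]
      nlinarith [le_max_right 1 cfg.lam]
    obtain ⟨z, hz⟩ := Finite.exists_max f
    have hfB : ∀ x, |f x| ≤ B := by
      intro x
      rw [hf]
      refine (abs_real_inner_le_norm _ _).trans ?_
      have : ‖φ x‖ ≤ 1 := by
        have := hk1 x
        rw [hk.self_eq_norm_sq] at this
        exact (sq_le_one_iff₀ (norm_nonneg _)).1 this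
      calc ‖g‖ * ‖φ x‖ ≤ B * 1 := mul_le_mul hg this (norm_nonneg _) hB
        _ = B := mul_one B
    -- The maximizer `z` does not depend on the noise, so the signs are fixed in advance and one
    -- application with total failure probability δ suffices.
    have hconf := measure_not_confidence_le hk hlam hδ hδ1 hβ hN hg hf
      (s := fun x => if x = z then -1 else 1) (fun x => by split_ifs <;> simp)
    have hbudget : μ {ω | ∑ t ∈ Finset.range T, |c t ω| ≤ cfg.C}ᶜ = 0 := hN.budget
    refine le_trans ?_ (hconf.trans_eq (by simp))
    refine le_trans (measure_mono ?_) ((measure_union_le _ _).trans_eq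
      ((congrArg₂ (· + ·) rfl hbudget).trans (add_zero _)))
    rw [← Set.compl_inter, Set.compl_subset_compl]
    rintro ω ⟨hω1, hω2⟩
    have G : Config.GoodRun φ cfg f (fun t => ε t ω) (fun t => c t ω) T z :=
      { featureMap := hk
        kernel_le_one := hk1
        lam_pos := hlam
        one_lt_eta := heta
        psi_eq := hpsi
        psi_pos := hpsi0
        psi_le_one := hpsi1
        lam_mul_psi_le_one := hpsi2
        beta_nonneg := fun h => by rw [hβ]; exact hB.trans (le_betaSeq _ _ _ _ _ _)
        budget := hω2
        confident := hω1
        maximal := hz }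
    exact hlarge (G.regret_le hT hB hfB hδ hδ1 hβ hD hγ hQ)

end RGPPE

end

open RGPPE MeasureTheory ProbabilityTheory in
theorem corollary1 (B lam η : ℝ) (σ : ℝ≥0) (hB : 0 ≤ B) (hlam : 0 < lam) (hη : 1 < η) :
    ∃ K : ℝ, ∀ (X : Type*) [Fintype X] [DecidableEq X] [Nonempty X]
      (H : Type*) [NormedAddCommGroup H] [InnerProductSpace ℝ H] [CompleteSpace H]
      [RKHS ℝ H X ℝ] (f : H) (rule : PlayRule X)
      (Ω : Type*) [mΩ : MeasurableSpace Ω] (μ : Measure Ω) [IsProbabilityMeasure μ]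
      (ℱ : Filtration ℕ mΩ) (ε c : ℕ → Ω → ℝ) (T : ℕ) (C δ : ℝ),
      (∀ x y : X, rkernel H x y ≤ 1) → ‖f‖ ≤ B → 1 ≤ T → 0 ≤ C → 0 < δ → δ < 1 →
      IsCorruptedNoise μ ℱ σ C T ε c →
      let cfg : Config X := mainConfig (rkernel H) B σ lam η C δ T rule
      let γ : ℝ := maxInfoGain (rkernel H : X → X → ℝ) lam T
      RegularConfidenceBounds μ cfg f ε c T (2 * δ) ∧
      1 - δ ≤ μ.real {ω | ∀ h x,
        cfg.cleanMean f (fun t => ε t ω) (fun t => c t ω) T h x - f x ≤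
          cfg.beta h * cfg.epochStd f (fun t => ε t ω) (fun t => c t ω) T h x} ∧
      1 - δ ≤ μ.real {ω | ∀ h x,
        f x - cfg.cleanMean f (fun t => ε t ω) (fun t => c t ω) T h x ≤
          cfg.beta h * cfg.epochStd f (fun t => ε t ω) (fun t => c t ω) T h x} ∧
      1 - δ ≤ μ.real {ω | cfg.regret f (fun t => ε t ω + c t ω) T ≤
        K * (1 + Real.log T) *
          (Real.sqrt (1 + Real.log (Fintype.card X / δ) + Real.log (1 + Real.log T)) *
              Real.sqrt (T * γ) +
            C * γ ^ (3 / 2 : ℝ))} := by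
  refine ⟨regretConst B lam η σ, ?_⟩
  intro X _ _ _ H _ _ _ _ f rule Ω mΩ μ _ ℱ ε c T C δ hker hf hT hC hδ hδ1 hN cfg γ
  have hk : IsFeatureMap (fun x => RKHS.kerFun H x (1 : ℝ)) cfg.k := isFeatureMap_kerFun H
  have hfe : ∀ x, f x = inner ℝ f (RKHS.kerFun H x (1 : ℝ)) := fun x => by simp
  have hconf := fun (s : X → ℝ) (hs : ∀ x, |s x| = 1) =>
    measure_not_confidence_le (cfg := cfg) hk hlam hδ hδ1 rfl hN hf hfe hs
  have hup : μ {ω | ∀ h x, cfg.cleanMean f (fun t => ε t ω) (fun t => c t ω) T h x - f x ≤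
      cfg.beta h * cfg.epochStd f (fun t => ε t ω) (fun t => c t ω) T h x}ᶜ ≤
      ENNReal.ofReal δ := by
    simpa only [one_mul] using hconf (fun _ => 1) (by simp)
  have hlow : μ {ω | ∀ h x, f x - cfg.cleanMean f (fun t => ε t ω) (fun t => c t ω) T h x ≤
      cfg.beta h * cfg.epochStd f (fun t => ε t ω) (fun t => c t ω) T h x}ᶜ ≤
      ENNReal.ofReal δ := by
    simpa only [neg_one_mul, neg_sub] using hconf (fun _ => -1) (by simp)
  refine ⟨⟨betaSeq_monotone B σ lam Fintype.card_pos hδ, ?_⟩, one_sub_le_measureReal hδ.le hup,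
    one_sub_le_measureReal hδ.le hlow, one_sub_le_measureReal hδ.le ?_⟩
  · refine one_sub_le_measureReal (by positivity) ?_
    rw [two_mul, ENNReal.ofReal_add hδ.le hδ.le]
    refine le_trans (measure_mono ?_) ((measure_union_le _ _).trans (add_le_add hup hlow))
    rw [← Set.compl_inter, Set.compl_subset_compl]
    rintro ω ⟨h1, h2⟩ h x
    exact abs_sub_le_iff.2 ⟨h1 h x, h2 h x⟩
  · exact measure_not_regret_le (cfg := cfg) hk (fun x => hker x x) hlam hη rfl hδ hδ1 hT hC rfl
      hN hf hfe
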